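/- Let $\mathcal T$ be a theory (a class of models) over a many-sorted first-order signature $\Pi$ (structures have non-empty universes), and let $P\notin\Pi$ be a predicate symbol. A constrained $P$-clause $\phi(\bar x)\,\|\,C(\bar x)$ consists of a $\Pi$-formula $\phi$ and a finite multiset $C$ of literals $(\neg)P(x_1,\dots,x_m)$ with variable arguments; it stands for $\forall\bar x(\phi\to C)$. For a finite set $N$ of such clauses, $\mathcal A\models\exists P\,N$ means that some expansion of the $\Pi$-structure $\mathcal A$ by an interpretation of $P$ is a model of $N$. Let $\succ$ be a strict ordering on atoms, stable under substitutions, extended to literals with $\neg A\succ A$. Ordered resolution derives $(C\vee D)\sigma$ from (renamed apart) $P(\bar x)\vee C$ and $\neg P(\bar y)\vee D$, where $\sigma$ is a most general unifier of $P(\bar x),P(\bar y)$, $P(\bar x)\sigma$ is strictly maximal in $(P(\bar x)\vee C)\sigma$ and $\neg P(\bar y)\sigma$ is maximal in $(\neg P(\bar y)\vee D)\sigma$; ordered factorization derives $(P(\bar x)\vee C)\sigma$ from $P(\bar x)\vee P(\bar y)\vee C$ if $P(\bar x)\sigma$ is maximal in it. On constrained clauses the constraint of the conclusion is $(\phi_1\wedge\phi_2)\sigma$,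 resp. $\phi\sigma$. Theorem. Let $N=\{\phi_i(\bar x)\,\|\,C_i(\bar x)\mid i=1,\dots,n\}$ and $N_P=\{C_1,\dots,C_n\}$. Assume that the set of all clauses derivable from $N_P$ by ordered resolution and factorization is finite up to renaming of variables, $N_P^*=\{C_1,\dots,C_n,C_{n+1},\dots,C_{n+k}\}$, and let $\mathcal I_P$ be an explicitly given finite set of inferences that contains, up to renaming, exactly the possible inferences between clauses of $N_P^*$, each with a recorded conclusion $C_l(\bar z)$, a variant of a listed clause. If $\bot\notin N_P^*$, then $\exists P\,N\equiv_{\mathcal T}\top$, i.e. $\mathcal A\models\exists P\,N$ for every model $\mathcal A$ of $\mathcal T$. Assume $\bot\in N_P^*$ and let $\mathcal A$ be a model of $\mathcal T$. Let $CH_N$ be the set of constrained Horn clauses in new predicates $\mu_1,\dots,\mu_{n+k}$ consisting of $\phi_i(\bar x)\to\mu_i(\bar x)$ for $i\le n$; of $(\mu_i(\bar x)\wedge\mu_j(\bar y))\sigma\to\mu_l(\bar z)$ for each resolution inference in $\mathcal I_P$ of $C_l(\bar z)$ from $C_i(\bar x),C_j(\bar y)$ with m.g.u. $\sigma$; and of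 $\mu_i(\bar x)\sigma\to\mu_l(\bar z)$ for each factorization inference in $\mathcal I_P$ of $C_l(\bar z)$ from $C_i(\bar x)$ with m.g.u. $\sigma$. Then $CH_N$ has a least model $(\mu_i^{\mathcal A})_i$ over $\mathcal A$; let $\mathcal A^\mu$ be the corresponding expansion of $\mathcal A$. Moreover: (1) Let $N_A=\{\phi_i(\bar a)\,\|\,C_i(\bar a)\mid i\le n,\ \bar a \text{ in }\mathcal A\}$. The set $N_A^*=\{\mu_i^{\mathcal A}(\bar a)\,\|\,C_i(\bar a)\mid i\le n+k,\ \bar a\text{ in }\mathcal A\}$ is a saturation of $N_A$ up to redundancy, where $\xi\,\|\,D$ is redundant if the set contains some $\psi\,\|\,D$ with $\xi\to\psi$ true in $\mathcal A^\mu$. That is: all clauses in $N_A$ are redundant with respect to $N_A^*$; for every total well-founded ordering of the ground atoms $P(\bar a)$, all conclusions of ordered ground inferences from $N_A^*$ are redundant with respect to $N_A^*$; and whenever $\mu_i^{\mathcal A}(\bar a)$ holds, some $\xi\,\|\,C_i(\bar a)$ with $\xi$ true in $\mathcal A$ is derivable from $N_A$ by ground resolution and factorization. Furthermore, $N_A^*$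 describes the ground instances over $\mathcal A$ of the constrained clauses derivable from $N$ by ordered resolution and factorization: for every ground clause $D$, there are such a derivable $\xi(\bar z)\,\|\,C(\bar z)$ and $\bar a$ with $\mathcal A\models\xi(\bar a)$ and $C(\bar a)=D$ if and only if there are $i$ and $\bar a$ with $\mu_i^{\mathcal A}(\bar a)$ true and $C_i(\bar a)=D$. (2) $\mathcal A\models\exists P\,N$ if and only if $CH_N\cup\{\neg\mu_j(\bar x)\mid C_j=\bot\}$ is satisfiable with respect to $\mathrm{Th}(\mathcal A)$ (holds in an expansion of some model of $\mathrm{Th}(\mathcal A)$), and also if and only if $\mathcal A^\mu\models\forall\bar x\,\neg\mu_j(\bar x)$ for all $j$ with $C_j=\bot$. -/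

import Mathlib

universe u v w

/-! ## Many-sorted first-order logic -/

/-- A many-sorted signature: sorts, function symbols and predicate symbols with their arities. -/
structure Sig where
  Srt : Type u
  Fn : Type u
  Pr : Type u
  dom : Fn → List Srt
  cod : Fn → Srt
  ar : Pr → List Srt

/-- `Var Γ s`: the variables of sort `s` in the context `Γ`, a finite list of sorted variables. -/
inductive Var {S : Type u} : List S → S → Type u
  | zero {s : S} {Γ : List S} : Var (s :: Γ) s
  | succ {s t : S} {Γ : List S} : Var Γ t → Var (s :: Γ) t

/-- Sort-preserving maps between sorted families. With `X = Var Γ` and `Y = Var Δ` these are the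
substitutions of variables for variables, with `Y` the universes of a structure the valuations. -/
abbrev SMap {S : Type u} (X : S → Type v) (Y : S → Type w) := ∀ s : S, X s → Y s

def SMap.comp {S : Type*} {X Y Z : S → Type*} (g : SMap Y Z) (f : SMap X Y) : SMap X Z :=
  fun s x => g s (f s x)

def SMap.id {S : Type*} (X : S → Type*) : SMap X X := fun _ x => x

/-- Extension of a valuation by a value for one more variable. -/
def SMap.cons {S : Type*} {A : S → Type*} {s : S} {Γ : List S} (a : A s) (e : SMap (Var Γ) A) :
    SMap (Var (s :: Γ)) A
  | _, .zero => a
  | _, .succ x => e _ x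

/-- Extension of a substitution under a binder. -/
def SMap.lift {S : Type*} {Γ Δ : List S} (σ : SMap (Var Γ) (Var Δ)) (s : S) :
    SMap (Var (s :: Γ)) (Var (s :: Δ)) :=
  SMap.cons Var.zero (fun t x => Var.succ (σ t x))

/-- Terms over a signature, with variables from the context `Γ`. -/
inductive Tm (L : Sig.{u}) (Γ : List L.Srt) : L.Srt → Type u
  | var {s : L.Srt} : Var Γ s → Tm L Γ s
  | app (f : L.Fn) : (∀ p : Fin (L.dom f).length, Tm L Γ ((L.dom f).get p)) → Tm L Γ (L.cod f)

/-- First-order formulas with equality, with free variables from the context `Γ`. -/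
inductive Fm (L : Sig.{u}) : List L.Srt → Type u
  | falsum {Γ : List L.Srt} : Fm L Γ
  | eq {Γ : List L.Srt} {s : L.Srt} : Tm L Γ s → Tm L Γ s → Fm L Γ
  | pred {Γ : List L.Srt} (p : L.Pr) :
      (∀ i : Fin (L.ar p).length, Tm L Γ ((L.ar p).get i)) → Fm L Γ
  | imp {Γ : List L.Srt} : Fm L Γ → Fm L Γ → Fm L Γ
  | all {Γ : List L.Srt} (s : L.Srt) : Fm L (s :: Γ) → Fm L Γ

def Fm.verum {L : Sig.{u}} {Γ : List L.Srt} : Fm L Γ := .imp .falsum .falsum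

def Fm.and {L : Sig.{u}} {Γ : List L.Srt} (φ ψ : Fm L Γ) : Fm L Γ :=
  .imp (.imp φ (.imp ψ .falsum)) .falsum

def Tm.subst {L : Sig.{u}} {Γ Δ : List L.Srt} (σ : SMap (Var Γ) (Var Δ)) :
    {s : L.Srt} → Tm L Γ s → Tm L Δ s
  | _, .var x => .var (σ _ x)
  | _, .app f ts => .app f (fun p => (ts p).subst σ)

def Fm.subst {L : Sig.{u}} : {Γ Δ : List L.Srt} → SMap (Var Γ) (Var Δ) → Fm L Γ → Fm L Δ
  | _, _, _, .falsum => .falsum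
  | _, _, σ, .eq t t' => .eq (t.subst σ) (t'.subst σ)
  | _, _, σ, .pred p ts => .pred p (fun i => (ts i).subst σ)
  | _, _, σ, .imp φ ψ => .imp (φ.subst σ) (ψ.subst σ)
  | _, _, σ, .all s φ => .all s (φ.subst (σ.lift s))

/-- Structures: a non-empty universe for every sort, and interpretations of the symbols. -/
structure Str (L : Sig.{u}) where
  El : L.Srt → Type w
  nonempty : ∀ s, Nonempty (El s)
  fn : ∀ f : L.Fn, (∀ p : Fin (L.dom f).length, El ((L.dom f).get p)) → El (L.cod f)
  pr : ∀ p : L.Pr, (∀ i : Fin (L.ar p).length, El ((L.ar p).get i)) → Prop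

def Tm.val {L : Sig.{u}} (A : Str.{u, w} L) {Γ : List L.Srt} (e : SMap (Var Γ) A.El) :
    {s : L.Srt} → Tm L Γ s → A.El s
  | _, .var x => e _ x
  | _, .app f ts => A.fn f (fun p => (ts p).val A e)

/-- `φ.Holds A e`: the formula `φ` is true in `A` under the valuation `e`. -/
def Fm.Holds {L : Sig.{u}} (A : Str.{u, w} L) :
    {Γ : List L.Srt} → Fm L Γ → SMap (Var Γ) A.El → Prop
  | _, .falsum, _ => False
  | _, .eq t t', e => t.val A e = t'.val A e
  | _, .pred p ts, e => A.pr p (fun i => (ts i).val A e)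
  | _, .imp φ ψ, e => φ.Holds A e → ψ.Holds A e
  | _, .all s φ, e => ∀ a : A.El s, φ.Holds A (SMap.cons a e)

abbrev Sentence (L : Sig.{u}) := Fm L []

def Str.Models {L : Sig.{u}} (A : Str.{u, w} L) (ψ : Sentence L) : Prop :=
  ψ.Holds A (fun _ x => nomatch x)

/-- The first-order theory of `A`. -/
def Str.Th {L : Sig.{u}} (A : Str.{u, w} L) : Set (Sentence L) := {ψ | A.Models ψ}

/-! ## Clauses over a new predicate symbol `P` -/

/-- Atoms `P(x₁, …, x_m)` with arguments from the sorted family `X` (variables of a context, or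
elements of a structure), where `P` has arity `ar = s₁ … s_m`. -/
abbrev Atom {S : Type u} (ar : List S) (X : S → Type v) := ∀ p : Fin ar.length, X (ar.get p)

def Atom.map {S : Type*} {ar : List S} {X Y : S → Type*} (f : SMap X Y) (a : Atom ar X) :
    Atom ar Y := fun p => f _ (a p)

inductive Lit {S : Type u} (ar : List S) (X : S → Type v)
  | pos : Atom ar X → Lit ar X
  | neg : Atom ar X → Lit ar X

namespace Lit

variable {S : Type*} {ar : List S} {X Y : S → Type*}

def atom : Lit ar X → Atom ar X
  | pos a => a
  | neg a => a

def map (f : SMap X Y) : Lit ar X → Lit ar Y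
  | pos a => pos (a.map f)
  | neg a => neg (a.map f)

/-- Truth of a literal when `P` is interpreted as the set `I`. -/
def Holds (I : Set (Atom ar X)) : Lit ar X → Prop
  | pos a => a ∈ I
  | neg a => a ∉ I

/-- The literal ordering induced by an atom ordering: compare the atoms first; over the same atom
the negative literal is the larger one. -/
def Gt (gt : Atom ar X → Atom ar X → Prop) (l l' : Lit ar X) : Prop :=
  gt l.atom l'.atom ∨ ∃ a, l = neg a ∧ l' = pos a

/-- `l` is maximal in the clause `l ∨ C`. -/
def Maximal (gt : Atom ar X → Atom ar X → Prop) (l : Lit ar X) (C : Multiset (Lit ar X)) : Prop :=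
  ∀ l' ∈ C, ¬ Gt gt l' l

/-- `l` is strictly maximal in the clause `l ∨ C`. -/
def StrictlyMaximal (gt : Atom ar X → Atom ar X → Prop) (l : Lit ar X)
    (C : Multiset (Lit ar X)) : Prop :=
  ∀ l' ∈ C, ¬ Gt gt l' l ∧ l' ≠ l

end Lit

/-- Clauses as multisets of literals; the empty clause `⊥` is `0`. -/
abbrev Cls {S : Type u} (ar : List S) (X : S → Type v) := Multiset (Lit ar X)

/-- Instance of a clause under a substitution or a valuation. -/
def Cls.inst {S : Type*} {ar : List S} {X Y : S → Type*} (C : Cls ar X) (f : SMap X Y) :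
    Cls ar Y := Multiset.map (Lit.map f) C

/-- A clause `C(x̄)` in the predicate `P`, all arguments being variables of the tuple `x̄` (`ctx`).
The tuple may contain variables that do not occur in the clause. -/
structure PClause {S : Type u} (ar : List S) where
  ctx : List S
  lits : Cls ar (Var ctx)

/-- A constrained `P`-clause `φ(x̄) ∥ C(x̄)`. -/
structure CClause (L : Sig.{u}) (ar : List L.Srt) extends PClause ar where
  constr : Fm L ctx

/-- `A ⊨ ∃P N`: some expansion of `A` by an interpretation of `P` satisfies all clauses
`∀x̄ (φ(x̄) → C(x̄))` of `N`. -/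
def Str.ModelsExistsP {L : Sig.{u}} {ar : List L.Srt} (A : Str.{u, w} L)
    (N : Set (CClause L ar)) : Prop :=
  ∃ I : Set (Atom ar A.El), ∀ c ∈ N, ∀ e : SMap (Var c.ctx) A.El,
    c.constr.Holds A e → ∃ l ∈ c.lits.inst e, l.Holds I

/-- `F₀ ≡_T ∃P N`, for a theory `T` given by its class of models. -/
def EquivMod {L : Sig.{u}} {ar : List L.Srt} (T : Set (Str.{u, w} L)) (F₀ : Sentence L)
    (N : Set (CClause L ar)) : Prop :=
  ∀ A ∈ T, A.Models F₀ ↔ A.ModelsExistsP N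

/-! ## Ordered resolution and factorization -/

/-- A strict ordering on the atoms `P(x₁, …, x_m)` with variable arguments that is stable under
substitutions: what a strict ordering on terms that is stable under substitutions (with `P` as one
of the function symbols) amounts to on the atoms that occur in `P`-clauses. -/
structure IsStableOrder {S : Type u} {ar : List S}
    (gt : ∀ Γ : List S, Atom ar (Var Γ) → Atom ar (Var Γ) → Prop) : Prop where
  irrefl : ∀ Γ a, ¬ gt Γ a a
  trans : ∀ Γ a b c, gt Γ a b → gt Γ b c → gt Γ a c
  stable : ∀ Γ Δ (σ : SMap (Var Γ) (Var Δ)) a b, gt Γ a b → gt Δ (a.map σ) (b.map σ)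

/-- `σ` is a most general unifier of `P(x̄)` and `P(ȳ)`, atoms with variables from `X`: it unifies
them, and every unifier `τ` factors through `σ` (that is, `τ` is a function of `σ`). The context
`Δ` may contain further, unused variables. -/
structure IsMGU {S : Type u} {ar : List S} {X : S → Type u} {Δ : List S}
    (σ : SMap X (Var Δ)) (x y : Atom ar X) : Prop where
  unifies : x.map σ = y.map σ
  general : ∀ (Θ : List S) (τ : SMap X (Var Θ)), x.map τ = y.map τ →
    ∀ (s : S) (v v' : X s), σ s v = σ s v' → τ s v = τ s v'

/-- The variables of two premises that have been renamed apart. -/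
abbrev Apart {S : Type u} (Γ₁ Γ₂ : List S) (s : S) : Type u := Var Γ₁ s ⊕ Var Γ₂ s

def Apart.fst {S : Type u} (Γ₁ Γ₂ : List S) : SMap (Var Γ₁) (Apart Γ₁ Γ₂) := fun _ x => .inl x

def Apart.snd {S : Type u} (Γ₁ Γ₂ : List S) : SMap (Var Γ₂) (Apart Γ₁ Γ₂) := fun _ x => .inr x

/-- The data of a resolution inference with premises `P(x̄) ∨ C` and `¬P(ȳ) ∨ D`. -/
structure Resolution {S : Type u} {ar : List S} (c₁ c₂ : PClause ar) where
  x : Atom ar (Var c₁.ctx)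
  C : Cls ar (Var c₁.ctx)
  y : Atom ar (Var c₂.ctx)
  D : Cls ar (Var c₂.ctx)
  ctx : List S
  σ : SMap (Apart c₁.ctx c₂.ctx) (Var ctx)

namespace Resolution

variable {S : Type u} {ar : List S} {c₁ c₂ : PClause ar}

/-- The substitution `σ` on the variables of the first premise. -/
def σ₁ (r : Resolution c₁ c₂) : SMap (Var c₁.ctx) (Var r.ctx) := r.σ.comp (Apart.fst _ _)

/-- The substitution `σ` on the variables of the second premise. -/
def σ₂ (r : Resolution c₁ c₂) : SMap (Var c₂.ctx) (Var r.ctx) := r.σ.comp (Apart.snd _ _)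

/-- The conclusion `(C ∨ D)σ`. -/
def concl (r : Resolution c₁ c₂) : PClause ar := ⟨r.ctx, r.C.inst r.σ₁ + r.D.inst r.σ₂⟩

/-- The conditions of the ordered resolution rule. -/
structure Valid (gt : ∀ Γ : List S, Atom ar (Var Γ) → Atom ar (Var Γ) → Prop)
    (r : Resolution c₁ c₂) : Prop where
  prem₁ : c₁.lits = Lit.pos r.x ::ₘ r.C
  prem₂ : c₂.lits = Lit.neg r.y ::ₘ r.D
  mgu : IsMGU r.σ (r.x.map (Apart.fst _ _)) (r.y.map (Apart.snd _ _))
  max₁ : Lit.StrictlyMaximal (gt r.ctx) (Lit.pos (r.x.map r.σ₁)) (r.C.inst r.σ₁)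
  max₂ : Lit.Maximal (gt r.ctx) (Lit.neg (r.y.map r.σ₂)) (r.D.inst r.σ₂)

end Resolution

/-- The data of a factorization inference with premise `P(x̄) ∨ P(ȳ) ∨ C`. -/
structure Factorization {S : Type u} {ar : List S} (c : PClause ar) where
  x : Atom ar (Var c.ctx)
  y : Atom ar (Var c.ctx)
  C : Cls ar (Var c.ctx)
  ctx : List S
  σ : SMap (Var c.ctx) (Var ctx)

namespace Factorization

variable {S : Type u} {ar : List S} {c : PClause ar}

/-- The conclusion `(P(x̄) ∨ C)σ`. -/
def concl (r : Factorization c) : PClause ar := ⟨r.ctx, Cls.inst (Lit.pos r.x ::ₘ r.C) r.σ⟩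

/-- The conditions of the ordered factorization rule. -/
structure Valid (gt : ∀ Γ : List S, Atom ar (Var Γ) → Atom ar (Var Γ) → Prop)
    (r : Factorization c) : Prop where
  prem : c.lits = Lit.pos r.x ::ₘ Lit.pos r.y ::ₘ r.C
  mgu : IsMGU r.σ r.x r.y
  max : Lit.Maximal (gt r.ctx) (Lit.pos (r.x.map r.σ)) (r.C.inst r.σ)

end Factorization

/-- All constrained clauses derivable from `N` by ordered resolution and factorization of
constrained `P`-clauses (the calculus `HRes^P_≻`). -/
inductive HRes {L : Sig.{u}} {ar : List L.Srt}
    (gt : ∀ Γ : List L.Srt, Atom ar (Var Γ) → Atom ar (Var Γ) → Prop) (N : Set (CClause L ar)) :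
    CClause L ar → Prop
  | base (c : CClause L ar) : c ∈ N → HRes gt N c
  | res (c₁ c₂ : CClause L ar) (r : Resolution c₁.toPClause c₂.toPClause) :
      HRes gt N c₁ → HRes gt N c₂ → r.Valid gt →
      HRes gt N ⟨r.concl, Fm.and (c₁.constr.subst r.σ₁) (c₂.constr.subst r.σ₂)⟩
  | fact (c : CClause L ar) (r : Factorization c.toPClause) :
      HRes gt N c → r.Valid gt → HRes gt N ⟨r.concl, c.constr.subst r.σ⟩

/-- `c` is a variant of `d`, written `c(z̄)` with the variables of `d`. -/
def IsVariantVia {S : Type u} {ar : List S} (c d : PClause ar)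
    (z : SMap (Var c.ctx) (Var d.ctx)) : Prop :=
  (∀ s, Function.Injective (z s)) ∧ c.lits.inst z = d.lits

/-- A recorded resolution inference: from `C_i(x̄)` and `C_j(ȳ)` one obtains `C_k(z̄)`. -/
structure ResInf {S : Type u} {ar : List S} {ι : Type} (C : ι → PClause ar) (i j : ι) where
  inf : Resolution (C i) (C j)
  k : ι
  z : SMap (Var (C k).ctx) (Var inf.ctx)

/-- A recorded factorization inference: from `C_i(x̄)` one obtains `C_k(z̄)`. -/
structure FactInf {S : Type u} {ar : List S} {ι : Type} (C : ι → PClause ar) (i : ι) where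
  inf : Factorization (C i)
  k : ι
  z : SMap (Var (C k).ctx) (Var inf.ctx)

/-- A finite set of recorded inferences between the clauses `C_i`. -/
structure InferenceSet {S : Type u} {ar : List S} {ι : Type} (C : ι → PClause ar) where
  res : ∀ i j, Finset (ResInf C i j)
  fact : ∀ i, Finset (FactInf C i)

/-- The clauses `C_i` that can be obtained from those with `init i` by inferences in `I`. -/
inductive InferenceSet.Reaches {S : Type u} {ar : List S} {ι : Type} {C : ι → PClause ar}
    (I : InferenceSet C) (init : ι → Prop) : ι → Prop
  | base (i : ι) : init i → Reaches I init i
  | res (i j : ι) (s : ResInf C i j) : s ∈ I.res i j → Reaches I init i → Reaches I init j →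
      Reaches I init s.k
  | fact (i : ι) (s : FactInf C i) : s ∈ I.fact i → Reaches I init i → Reaches I init s.k

/-- The clauses `C_1, …, C_n` (the `P`-parts of `N`) followed by `C_{n+1}, …, C_{n+k}`. -/
def clauses {L : Sig.{u}} {ar : List L.Srt} {n k : ℕ} (N : Fin n → CClause L ar)
    (E : Fin k → PClause ar) : Fin n ⊕ Fin k → PClause ar :=
  Sum.elim (fun i => (N i).toPClause) E

/-- `{C_1, …, C_{n+k}}` is the saturation of `{C_1, …, C_n}` under ordered resolution and
factorization, clauses being identified with their variants, and `I` consists of the inferences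
between these clauses. -/
structure IsFiniteSaturation {L : Sig.{u}} {ar : List L.Srt} {n k : ℕ}
    (gt : ∀ Γ : List L.Srt, Atom ar (Var Γ) → Atom ar (Var Γ) → Prop)
    (N : Fin n → CClause L ar) (E : Fin k → PClause ar) (I : InferenceSet (clauses N E)) : Prop where
  /-- `I` contains only inferences of the calculus, with the recorded conclusions. -/
  res_valid : ∀ i j, ∀ s ∈ I.res i j,
    s.inf.Valid gt ∧ IsVariantVia (clauses N E s.k) s.inf.concl s.z
  fact_valid : ∀ i, ∀ s ∈ I.fact i,
    s.inf.Valid gt ∧ IsVariantVia (clauses N E s.k) s.inf.concl s.z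
  /-- Up to the choice of the most general unifier, `I` contains every possible inference; so all
  conclusions are (variants of) clauses in the list. -/
  res_complete : ∀ i j (r : Resolution (clauses N E i) (clauses N E j)), r.Valid gt →
    ∃ s ∈ I.res i j, s.inf.x = r.x ∧ s.inf.y = r.y
  fact_complete : ∀ i (r : Factorization (clauses N E i)), r.Valid gt →
    ∃ s ∈ I.fact i, s.inf.x = r.x ∧ s.inf.y = r.y
  /-- Every clause in the list is derived from the initial ones. -/
  derived : ∀ i, I.Reaches (fun i => i.isLeft = true) i

/-! ## Constrained Horn clauses -/

/-- `μ_i(z̄)`, where `μ_i` is an uninterpreted predicate whose arguments are the tuple `Γs i`, and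
`z̄` consists of variables from `Δ`. -/
structure MuAtom {S : Type u} {ι : Type} (Γs : ι → List S) (Δ : List S) where
  idx : ι
  args : SMap (Var (Γs idx)) (Var Δ)

/-- A constrained Horn clause `φ ∧ μ_{i₁}(z̄₁) ∧ … ∧ μ_{iᵣ}(z̄ᵣ) → head`, universally quantified
over `ctx`; the head is an atom `μ_i(z̄)`, or `⊥` (`none`) for a goal clause. -/
structure HornClause (L : Sig.{u}) {ι : Type} (Γs : ι → List L.Srt) where
  ctx : List L.Srt
  constr : Fm L ctx
  body : List (MuAtom Γs ctx)
  head : Option (MuAtom Γs ctx)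

/-- Interpretations of the predicates `μ_i` in `A`. -/
abbrev MuInterp {L : Sig.{u}} {ι : Type} (A : Str.{u, w} L) (Γs : ι → List L.Srt) :=
  ∀ i : ι, Set (SMap (Var (Γs i)) A.El)

def MuAtom.Holds {L : Sig.{u}} {ι : Type} {Γs : ι → List L.Srt} {Δ : List L.Srt}
    {A : Str.{u, w} L} (M : MuInterp A Γs) (a : MuAtom Γs Δ) (e : SMap (Var Δ) A.El) : Prop :=
  e.comp a.args ∈ M a.idx

/-- `h` is true in the expansion of `A` by `M`. -/
def HornClause.Holds {L : Sig.{u}} {ι : Type} {Γs : ι → List L.Srt} {A : Str.{u, w} L}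
    (M : MuInterp A Γs) (h : HornClause L Γs) : Prop :=
  ∀ e : SMap (Var h.ctx) A.El, h.constr.Holds A e → (∀ b ∈ h.body, b.Holds M e) →
    ∃ a ∈ h.head, a.Holds M e

def HornModels {L : Sig.{u}} {ι : Type} {Γs : ι → List L.Srt} (A : Str.{u, w} L)
    (M : MuInterp A Γs) (H : Set (HornClause L Γs)) : Prop :=
  ∀ h ∈ H, h.Holds M

/-- `H` is satisfiable w.r.t. `Th(A)`: some model of `Th(A)` has an expansion that satisfies `H`. -/
def SatisfiableModTh {L : Sig.{u}} {ι : Type} {Γs : ι → List L.Srt} (A : Str.{u, w} L)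
    (H : Set (HornClause L Γs)) : Prop :=
  ∃ B : Str.{u, w} L, (∀ ψ ∈ A.Th, B.Models ψ) ∧ ∃ M : MuInterp B Γs, HornModels B M H

/-- The tuples of arguments of the predicates `μ_1, …, μ_{n+k}`. -/
abbrev muCtx {L : Sig.{u}} {ar : List L.Srt} {n k : ℕ} (N : Fin n → CClause L ar)
    (E : Fin k → PClause ar) : Fin n ⊕ Fin k → List L.Srt :=
  fun i => (clauses N E i).ctx

/-- The set `CH_N` of constrained Horn clauses. -/
def CH {L : Sig.{u}} {ar : List L.Srt} {n k : ℕ} (N : Fin n → CClause L ar)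
    (E : Fin k → PClause ar) (I : InferenceSet (clauses N E)) : Set (HornClause L (muCtx N E)) :=
  {h | ∃ i : Fin n, h =
    { ctx := (N i).ctx
      constr := (N i).constr
      body := []
      head := some ⟨.inl i, SMap.id _⟩ }} ∪
  {h | ∃ i j, ∃ s ∈ I.res i j, h =
    { ctx := s.inf.ctx
      constr := .verum
      body := [⟨i, s.inf.σ₁⟩, ⟨j, s.inf.σ₂⟩]
      head := some ⟨s.k, s.z⟩ }} ∪
  {h | ∃ i, ∃ s ∈ I.fact i, h =
    { ctx := s.inf.ctx
      constr := .verum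
      body := [⟨i, s.inf.σ⟩]
      head := some ⟨s.k, s.z⟩ }}

/-- The goal clauses `¬μ_j(x̄)` with `C_j = ⊥`. (If no clause is listed twice, there is exactly one
such `j` as soon as `⊥` is in the list.) -/
def negMuBot {L : Sig.{u}} {ar : List L.Srt} {n k : ℕ} (N : Fin n → CClause L ar)
    (E : Fin k → PClause ar) : Set (HornClause L (muCtx N E)) :=
  {h | ∃ j, (clauses N E j).lits = 0 ∧ h =
    { ctx := (clauses N E j).ctx
      constr := .verum
      body := [⟨j, SMap.id _⟩]
      head := none }}

/-! ## Ground constrained clauses over a structure -/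

/-- Ground constraints over `A^μ`: instances `φ(ā)` of formulas and atoms `μ_i(ā)`, where `ā` are
elements of `A`, and conjunctions of these. -/
inductive GConstr {L : Sig.{u}} {ι : Type} (A : Str.{u, w} L) (Γs : ι → List L.Srt)
  | form {Γ : List L.Srt} (φ : Fm L Γ) (a : SMap (Var Γ) A.El) : GConstr A Γs
  | mu (i : ι) (a : SMap (Var (Γs i)) A.El) : GConstr A Γs
  | and : GConstr A Γs → GConstr A Γs → GConstr A Γs

/-- Truth of a ground constraint in the expansion of `A` by `M`. -/
def GConstr.Holds {L : Sig.{u}} {ι : Type} {A : Str.{u, w} L} {Γs : ι → List L.Srt}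
    (M : MuInterp A Γs) : GConstr A Γs → Prop
  | form φ a => φ.Holds A a
  | mu i a => a ∈ M i
  | and ξ ξ' => ξ.Holds M ∧ ξ'.Holds M

/-- Ground constrained clauses `ξ ∥ D` over `A`. -/
structure GClause {L : Sig.{u}} {ι : Type} (A : Str.{u, w} L) (Γs : ι → List L.Srt)
    (ar : List L.Srt) where
  constr : GConstr A Γs
  lits : Cls ar A.El

section Ground

variable {L : Sig.{u}} {ι : Type} {A : Str.{u, w} L} {Γs : ι → List L.Srt} {ar : List L.Srt}

/-- `d = (ψ ∥ D)` semantically entails `c = (ξ ∥ C)`: `C = D`, and `ξ → ψ` is true in the expansion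
of `A` by `M`. -/
def GClause.Entails (M : MuInterp A Γs) (d c : GClause A Γs ar) : Prop :=
  c.lits = d.lits ∧ (c.constr.Holds M → d.constr.Holds M)

/-- Ground clauses derivable from `N` by (unrestricted) ground resolution and factorization. -/
inductive GDerivable (N : Set (GClause A Γs ar)) : GClause A Γs ar → Prop
  | base (c : GClause A Γs ar) : c ∈ N → GDerivable N c
  | res (ξ ξ' : GConstr A Γs) (a : Atom ar A.El) (C D : Cls ar A.El) :
      GDerivable N ⟨ξ, Lit.pos a ::ₘ C⟩ → GDerivable N ⟨ξ', Lit.neg a ::ₘ D⟩ →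
      GDerivable N ⟨ξ.and ξ', C + D⟩
  | fact (ξ : GConstr A Γs) (a : Atom ar A.El) (C : Cls ar A.El) :
      GDerivable N ⟨ξ, Lit.pos a ::ₘ Lit.pos a ::ₘ C⟩ → GDerivable N ⟨ξ, Lit.pos a ::ₘ C⟩

/-- `c` is the conclusion of an inference of the ordered ground calculus from clauses in `N`. -/
inductive GInference (gt : Atom ar A.El → Atom ar A.El → Prop) (N : Set (GClause A Γs ar)) :
    GClause A Γs ar → Prop
  | res (ξ ξ' : GConstr A Γs) (a : Atom ar A.El) (C D : Cls ar A.El) :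
      ⟨ξ, Lit.pos a ::ₘ C⟩ ∈ N → ⟨ξ', Lit.neg a ::ₘ D⟩ ∈ N →
      Lit.StrictlyMaximal gt (Lit.pos a) C → Lit.Maximal gt (Lit.neg a) D →
      GInference gt N ⟨ξ.and ξ', C + D⟩
  | fact (ξ : GConstr A Γs) (a : Atom ar A.El) (C : Cls ar A.El) :
      ⟨ξ, Lit.pos a ::ₘ Lit.pos a ::ₘ C⟩ ∈ N → Lit.Maximal gt (Lit.pos a) C →
      GInference gt N ⟨ξ, Lit.pos a ::ₘ C⟩

/-- A total well-founded strict ordering on the ground atoms over `A`. -/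
structure IsGroundOrder (gt : Atom ar A.El → Atom ar A.El → Prop) : Prop where
  irrefl : ∀ a, ¬ gt a a
  trans : ∀ a b c, gt a b → gt b c → gt a c
  total : ∀ a b, a ≠ b → gt a b ∨ gt b a
  wf : WellFounded (fun a b => gt b a)

/-- `N'` is a saturation of `N`, up to semantic entailment in the expansion of `A` by `M`. -/
structure IsGroundSaturation (M : MuInterp A Γs) (N N' : Set (GClause A Γs ar)) : Prop where
  /-- The clauses of `N` are in `N'`, up to redundancy. -/
  contains : ∀ c ∈ N, ∃ d ∈ N', d.Entails M c
  /-- The clauses of `N'` are derived from `N`: a true constraint of a clause in `N'` is the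
  disjunction of constraints with which that clause is derivable from `N`. -/
  derived : ∀ d ∈ N', d.constr.Holds M →
    ∃ c, GDerivable N c ∧ c.lits = d.lits ∧ c.constr.Holds M
  /-- `N'` is closed under ordered inferences, up to redundancy. -/
  closed : ∀ gt : Atom ar A.El → Atom ar A.El → Prop, IsGroundOrder gt →
    ∀ c, GInference gt N' c → ∃ d ∈ N', d.Entails M c

end Ground

/-- The set `N_A` of all instances `φ_i(ā) ∥ C_i(ā)` of `N` over `A`. -/
def groundN {L : Sig.{u}} {ar : List L.Srt} {n k : ℕ} (A : Str.{u, w} L)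
    (N : Fin n → CClause L ar) (E : Fin k → PClause ar) : Set (GClause A (muCtx N E) ar) :=
  {c | ∃ (i : Fin n) (a : SMap (Var (N i).ctx) A.El),
    c = ⟨.form (N i).constr a, (N i).lits.inst a⟩}

/-- The set of all clauses `μ_i(ā) ∥ C_i(ā)`, `i = 1, …, n + k`, over `A`. -/
def groundMu {L : Sig.{u}} {ar : List L.Srt} {n k : ℕ} (A : Str.{u, w} L)
    (N : Fin n → CClause L ar) (E : Fin k → PClause ar) : Set (GClause A (muCtx N E) ar) :=
  {c | ∃ (i : Fin n ⊕ Fin k) (a : SMap (Var (muCtx N E i)) A.El),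
    c = ⟨.mu i a, (clauses N E i).lits.inst a⟩}

/-! All arguments of atoms are variables, so a strict order stable under substitutions is empty on
them (`IsStableOrder.not_gt`). The ordering conditions therefore shrink to syntactic ones. In
resolution, after unification, the resolved positive atom differs from all other atoms of its
premise. In factorization, the complement of the unified literal does not occur in the rest of the
clause. Ground inferences with these properties lift, because a most general unifier identifies no
more variables than the ground valuations do (`IsCHModel.exists_resolvent`,
`IsCHModel.exists_factor`).

Hence for every model `M` of `CH_N` over `A`, the instances `C_i(a)` with `a ∈ M i` are closed under
ground ordered inferences. If `⊥` is not among them, the candidate model construction of Bachmair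
and Ganzinger (`exists_model_of_closed`) yields an interpretation of `P`. Conversely, an
interpretation of `P` satisfying `N` gives a model of `CH_N` in which `μ_i(a)` means that `C_i(a)`
is true; there the goal clauses hold, as `⊥` is never true.

Models of `CH_N` are closed under intersection, so there is a least one. Whatever holds of the true
`μ_i(a)` is proved by minimality: the tuples that come from some derivation form a model of `CH_N`.

What remains is the passage from a model `B` of `Th(A)` back to `A`. If `A ⊭ ∃P N`, then some `μ_j`
with `C_j = ⊥` is inhabited, so one clause `ξ ∥ ⊥` with `ξ` satisfiable in `A` is derivable
(`exists_hRes_inst_eq_iff`). As `ξ` is a first-order formula, it is satisfiable in `B`, and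
`HRes.sound` refutes `B ⊨ ∃P N`. This needs arbitrary derivations to match the recorded inferences
up to renaming. Since contexts may have unused variables, clauses are compared inside a common
family of variables, and the comparison is carried through each inference by a pushout of most
general unifiers (`IsMGU.exists_pushout`). -/

/-! ## Renaming atoms, literals and clauses -/

section Instances

variable {S : Type*} {ar : List S} {X Y Z : S → Type*}

theorem Lit.atom_map (f : SMap X Y) (l : Lit ar X) : (l.map f).atom = l.atom.map f := by
  cases l <;> rfl

theorem Lit.map_map (g : SMap Y Z) (f : SMap X Y) (l : Lit ar X) :
    (l.map f).map g = l.map (g.comp f) := by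
  cases l <;> rfl

theorem Atom.map_injective {f : SMap X Y} (hf : ∀ s, Function.Injective (f s)) :
    Function.Injective (Atom.map f : Atom ar X → Atom ar Y) := by
  intro a b h
  funext p
  exact hf _ (congrFun h p)

theorem Lit.map_injective {f : SMap X Y} (hf : ∀ s, Function.Injective (f s)) :
    Function.Injective (Lit.map f : Lit ar X → Lit ar Y) := by
  rintro (a | a) (b | b) h <;> simp only [Lit.map, Lit.pos.injEq, Lit.neg.injEq, reduceCtorEq] at h
  · rw [Atom.map_injective hf h]
  · rw [Atom.map_injective hf h]

theorem Lit.map_eq_pos {f : SMap X Y} {l : Lit ar X} {a : Atom ar Y} (h : l.map f = .pos a) :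
    ∃ x, l = .pos x ∧ x.map f = a := by
  cases l with
  | pos x => exact ⟨x, rfl, Lit.pos.inj h⟩
  | neg x => cases h

theorem Lit.map_eq_neg {f : SMap X Y} {l : Lit ar X} {a : Atom ar Y} (h : l.map f = .neg a) :
    ∃ x, l = .neg x ∧ x.map f = a := by
  cases l with
  | neg x => exact ⟨x, rfl, Lit.neg.inj h⟩
  | pos x => cases h

theorem Cls.inst_inst (g : SMap Y Z) (f : SMap X Y) (C : Cls ar X) :
    (C.inst f).inst g = C.inst (g.comp f) := by
  simp only [Cls.inst, Multiset.map_map]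
  exact Multiset.map_congr rfl fun l _ => Lit.map_map g f l

theorem Cls.inst_cons (f : SMap X Y) (l : Lit ar X) (C : Cls ar X) :
    Cls.inst (l ::ₘ C) f = l.map f ::ₘ C.inst f := Multiset.map_cons ..

theorem Cls.inst_add (f : SMap X Y) (C D : Cls ar X) :
    Cls.inst (C + D) f = C.inst f + D.inst f := Multiset.map_add ..

theorem Cls.inst_eq_zero {f : SMap X Y} {C : Cls ar X} : C.inst f = 0 ↔ C = 0 :=
  Multiset.map_eq_zero

theorem Cls.mem_inst {f : SMap X Y} {C : Cls ar X} {l : Lit ar Y} :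
    l ∈ C.inst f ↔ ∃ l' ∈ C, l'.map f = l := Multiset.mem_map

theorem Cls.inst_eq_cons {f : SMap X Y} {C : Cls ar X} {l : Lit ar Y} {D : Cls ar Y}
    (h : C.inst f = l ::ₘ D) : ∃ l' C', C = l' ::ₘ C' ∧ l'.map f = l ∧ Cls.inst C' f = D := by
  classical
  obtain ⟨l', hl', h₁, h₂⟩ := (Multiset.map_eq_cons _ _ _ _).2 h
  exact ⟨l', C.erase l', (Multiset.cons_erase hl').symm, h₁, h₂⟩

theorem Cls.inst_eq_pos_cons {f : SMap X Y} {C : Cls ar X} {a : Atom ar Y} {D : Cls ar Y}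
    (h : C.inst f = .pos a ::ₘ D) :
    ∃ x C', C = .pos x ::ₘ C' ∧ x.map f = a ∧ Cls.inst C' f = D := by
  obtain ⟨l, C', h₁, h₂, h₃⟩ := Cls.inst_eq_cons h
  obtain ⟨x, rfl, hx⟩ := Lit.map_eq_pos h₂
  exact ⟨x, C', h₁, hx, h₃⟩

theorem Cls.inst_eq_neg_cons {f : SMap X Y} {C : Cls ar X} {a : Atom ar Y} {D : Cls ar Y}
    (h : C.inst f = .neg a ::ₘ D) :
    ∃ x C', C = .neg x ::ₘ C' ∧ x.map f = a ∧ Cls.inst C' f = D := by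
  obtain ⟨l, C', h₁, h₂, h₃⟩ := Cls.inst_eq_cons h
  obtain ⟨x, rfl, hx⟩ := Lit.map_eq_neg h₂
  exact ⟨x, C', h₁, hx, h₃⟩

/-- Off the range of `σ` the values of `ρ` are arbitrary; this is where non-empty universes enter.
-/
theorem SMap.exists_comp_eq (σ : SMap X Y) (τ : SMap X Z) [∀ s, Nonempty (Z s)]
    (h : ∀ s v v', σ s v = σ s v' → τ s v = τ s v') : ∃ ρ : SMap Y Z, ρ.comp σ = τ := by
  have key : ∀ s, ∃ ρ : Y s → Z s, τ s = ρ ∘ σ s := fun s =>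
    (Function.factorsThrough_iff (f := σ s) (τ s)).1 (fun v v' hv => h s v v' hv)
  choose ρ hρ using key
  exact ⟨ρ, funext fun s => (hρ s).symm⟩

end Instances

/-! ## Truth of formulas -/

section Formulas

theorem SMap.cons_comp_lift {S : Type*} {Γ Δ : List S} {A : S → Type*} {s : S} (a : A s)
    (e : SMap (Var Δ) A) (σ : SMap (Var Γ) (Var Δ)) :
    (SMap.cons a e).comp (σ.lift s) = SMap.cons a (e.comp σ) := by
  funext t x
  cases x <;> rfl

variable {L : Sig.{u}} (A : Str.{u, w} L)

theorem Tm.val_subst {Γ Δ : List L.Srt} (σ : SMap (Var Γ) (Var Δ)) (e : SMap (Var Δ) A.El)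
    {s : L.Srt} (t : Tm L Γ s) : (t.subst σ).val A e = t.val A (e.comp σ) := by
  induction t with
  | var x => rfl
  | app f ts ih =>
    simp only [Tm.subst, Tm.val]
    congr 1
    funext p
    exact ih p

theorem Fm.holds_subst {Γ Δ : List L.Srt} (σ : SMap (Var Γ) (Var Δ)) (e : SMap (Var Δ) A.El)
    (φ : Fm L Γ) : (φ.subst σ).Holds A e ↔ φ.Holds A (e.comp σ) := by
  induction φ generalizing Δ with
  | falsum => rfl
  | eq t t' => simp only [Fm.subst, Fm.Holds, Tm.val_subst]
  | pred p ts => simp only [Fm.subst, Fm.Holds, Tm.val_subst]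
  | imp φ ψ ih₁ ih₂ => simp only [Fm.subst, Fm.Holds, ih₁, ih₂]
  | all s φ ih => simp only [Fm.subst, Fm.Holds, ih, SMap.cons_comp_lift]

theorem Fm.holds_and {Γ : List L.Srt} (φ ψ : Fm L Γ) (e : SMap (Var Γ) A.El) :
    (φ.and ψ).Holds A e ↔ φ.Holds A e ∧ ψ.Holds A e := by
  simp only [Fm.and, Fm.Holds]
  tauto

theorem Fm.holds_verum {Γ : List L.Srt} (e : SMap (Var Γ) A.El) :
    (Fm.verum : Fm L Γ).Holds A e := id

/-- The universal closure of a formula. -/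
def Fm.closure : {Γ : List L.Srt} → Fm L Γ → Sentence L
  | [], φ => φ
  | s :: _, φ => (Fm.all s φ).closure

theorem Fm.models_closure {Γ : List L.Srt} (φ : Fm L Γ) :
    A.Models φ.closure ↔ ∀ e, φ.Holds A e := by
  induction Γ with
  | nil =>
    refine ⟨fun h e => ?_, fun h => h _⟩
    have : e = fun _ x => nomatch x := by
      funext s x
      cases x
    rw [this]
    exact h
  | cons s Γ ih =>
    refine (ih (Fm.all s φ)).trans ⟨fun h e => ?_, fun h e a => h _⟩
    have : e = SMap.cons (e s .zero) (fun t x => e t (.succ x)) := by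
      funext t x
      cases x <;> rfl
    rw [this]
    exact h _ _

/-- Elementary equivalence preserves satisfiability of formulas. -/
theorem Fm.exists_holds_of_models_th {B : Str.{u, w} L} (hB : ∀ ψ ∈ A.Th, B.Models ψ)
    {Γ : List L.Srt} (φ : Fm L Γ) {e : SMap (Var Γ) A.El} (he : φ.Holds A e) :
    ∃ e' : SMap (Var Γ) B.El, φ.Holds B e' := by
  by_contra hne
  -- The sentence `¬∀¬φ`, which expresses satisfiability of `φ`.
  have hA : (Fm.imp (Fm.imp φ .falsum).closure .falsum : Sentence L) ∈ A.Th := fun h =>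
    (Fm.models_closure A _).1 h e he
  exact hB _ hA ((Fm.models_closure B (Fm.imp φ .falsum)).2 fun e' he' => hne ⟨e', he'⟩)

end Formulas

/-! ## Most general unifiers of atoms with variable arguments -/

section Unifiers

variable {S : Type u}

/-- An order that is stable under substitutions of variables for variables is empty, as a
substitution can identify all variables of the same sort. -/
theorem IsStableOrder.not_gt {ar : List S}
    {gt : ∀ Γ : List S, Atom ar (Var Γ) → Atom ar (Var Γ) → Prop} (hgt : IsStableOrder gt)
    {Γ : List S} (a b : Atom ar (Var Γ)) : ¬ gt Γ a b := fun h =>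
  -- By proof irrelevance the chosen variable depends on the sort only, so `a` and `b` have the same
  -- image.
  hgt.irrefl Γ _ (hgt.stable Γ Γ (fun _ v => Classical.choice ⟨v⟩) a b h)

def Var.appendLeft {s : S} (Δ : List S) : {Γ : List S} → Var Γ s → Var (Γ ++ Δ) s
  | _, .zero => .zero
  | _, .succ v => .succ (v.appendLeft Δ)

def Var.appendRight {s : S} {Δ : List S} : (Γ : List S) → Var Δ s → Var (Γ ++ Δ) s
  | [], v => v
  | _ :: Γ, v => .succ (v.appendRight Γ)

theorem Var.appendLeft_injective {s : S} (Δ : List S) {Γ : List S} :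
    Function.Injective (Var.appendLeft Δ : Var Γ s → Var (Γ ++ Δ) s) := by
  intro v
  induction v with
  | zero =>
    intro v' h
    cases v' with
    | zero => rfl
    | succ v' => cases h
  | succ v ih =>
    intro v' h
    cases v' with
    | zero => cases h
    | succ v' => rw [ih (Var.succ.inj h)]

theorem Var.appendRight_injective {s : S} {Δ : List S} (Γ : List S) :
    Function.Injective (Var.appendRight Γ : Var Δ s → Var (Γ ++ Δ) s) := by
  induction Γ with
  | nil => exact fun _ _ h => h
  | cons t Γ ih => exact fun v v' h => ih (Var.succ.inj h)

theorem Var.appendLeft_ne_appendRight {s : S} {Γ Δ : List S} (v : Var Γ s) (v' : Var Δ s) :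
    v.appendLeft Δ ≠ v'.appendRight Γ := by
  induction v with
  | zero => exact fun h => by cases h
  | succ v ih => exact fun h => ih v' (Var.succ.inj h)

/-- A family of variables that can be embedded into a context. -/
def IsFinitary (X : S → Type u) : Prop :=
  ∃ (Γ : List S) (ε : SMap X (Var Γ)), ∀ s, Function.Injective (ε s)

theorem isFinitary_var (Γ : List S) : IsFinitary (Var Γ) :=
  ⟨Γ, SMap.id _, fun _ _ _ h => h⟩

theorem isFinitary_apart (Γ₁ Γ₂ : List S) : IsFinitary (Apart Γ₁ Γ₂) :=
  ⟨Γ₁ ++ Γ₂, fun _ => Sum.elim (Var.appendLeft Γ₂) (Var.appendRight Γ₁), fun _ =>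
    (Var.appendLeft_injective Γ₂).sumElim (Var.appendRight_injective Γ₁)
      Var.appendLeft_ne_appendRight⟩

variable {ar : List S} {X : S → Type u}

/-- Two variables are identified exactly when every unifier identifies them; sending each to a
representative of its class is most general. The target is the whole context `Γ` of the embedding,
which may leave unused variables. -/
theorem exists_isMGU (hX : IsFinitary X) (x y : Atom ar X) :
    ∃ (Δ : List S) (σ : SMap X (Var Δ)), IsMGU σ x y := by
  obtain ⟨Γ, ε, hε⟩ := hX
  let R (s : S) : Setoid (X s) :=
    { r := fun v v' => ∀ (Θ : List S) (τ : SMap X (Var Θ)), x.map τ = y.map τ → τ s v = τ s v'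
      iseqv := ⟨fun _ _ _ _ => rfl, fun h Θ τ hτ => (h Θ τ hτ).symm,
        fun h h' Θ τ hτ => (h Θ τ hτ).trans (h' Θ τ hτ)⟩ }
  refine ⟨Γ, fun s v => ε s (Quotient.mk (R s) v).out, ?_, ?_⟩
  · funext p
    have : Quotient.mk (R _) (x p) = Quotient.mk (R _) (y p) :=
      Quotient.sound fun Θ τ hτ => congrFun hτ p
    simp only [Atom.map, this]
  · intro Θ τ hτ s v v' h
    exact Quotient.exact (Quotient.out_injective (hε s h)) Θ τ hτ

/-- A most general unifier is most general also among the unifiers with values in an arbitrary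
sorted family. -/
theorem IsMGU.eq_of_eq (hX : IsFinitary X) {Δ : List S} {σ : SMap X (Var Δ)}
    {x y : Atom ar X} (hσ : IsMGU σ x y) {Y : S → Type*} (τ : SMap X Y)
    (hτ : x.map τ = y.map τ) {s : S} {v v' : X s} (h : σ s v = σ s v') : τ s v = τ s v' := by
  obtain ⟨Γ, ε, hε⟩ := hX
  -- `IsMGU.general` speaks only of values in contexts. Each value of `τ` is replaced by a chosen
  -- variable in its fibre; the choice depends on the value alone, so the new map identifies the
  -- same variables as `τ`.
  have hex : ∀ s (v : X s), ∃ v', τ s v' = τ s v := fun s v => ⟨v, rfl⟩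
  have heq : ∀ s (v v' : X s), τ s v = τ s v' → (hex s v).choose = (hex s v').choose := by
    intro s v v' h
    simp only [h]
  have := hσ.general Γ (fun s v => ε s (hex s v).choose)
    (funext fun p => congrArg (ε _) (heq _ _ _ (congrFun hτ p))) s v v' h
  rw [← (hex s v).choose_spec, hε s this, (hex s v').choose_spec]

/-- Unifiers with values in an arbitrary sorted family factor through a most general unifier. -/
theorem IsMGU.exists_comp_eq (hX : IsFinitary X) {Δ : List S} {σ : SMap X (Var Δ)}
    {x y : Atom ar X} (hσ : IsMGU σ x y) {Y : S → Type*} [∀ s, Nonempty (Y s)] (τ : SMap X Y)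
    (hτ : x.map τ = y.map τ) : ∃ ρ : SMap (Var Δ) Y, ρ.comp σ = τ :=
  SMap.exists_comp_eq σ τ fun _ _ _ h => hσ.eq_of_eq hX τ hτ h

/-- Two most general unifiers of corresponding atoms, one over variables `U` and one over
variables `V`, where the variables are compared in a common family `X`, can be compared in a common
family, the pushout. -/
theorem IsMGU.exists_pushout {U V : S → Type u} (hU : IsFinitary U) (hV : IsFinitary V)
    {Z : SMap U X} {W : SMap V X} (hZ : ∀ s, Function.Injective (Z s))
    (hW : ∀ s, Function.Injective (W s)) {Δ Δ' : List S} {τ : SMap U (Var Δ)}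
    {σ : SMap V (Var Δ')} {x y : Atom ar U} {x' y' : Atom ar V} (hτ : IsMGU τ x y)
    (hσ : IsMGU σ x' y') (hx : x.map Z = x'.map W) (hy : y.map Z = y'.map W) :
    ∃ (X' : S → Type u) (z : SMap (Var Δ) X') (w : SMap (Var Δ') X') (h : SMap X X'),
      (∀ s, Function.Injective (z s)) ∧ (∀ s, Function.Injective (w s)) ∧
      z.comp τ = h.comp Z ∧ w.comp σ = h.comp W ∧
      ∀ (Y : S → Type w) (f : SMap (Var Δ) Y) (g : SMap (Var Δ') Y) (e : SMap X Y),
        f.comp τ = e.comp Z → g.comp σ = e.comp W →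
        ∃ e' : SMap X' Y, e'.comp z = f ∧ e'.comp w = g := by
  -- The pushout is the disjoint union of `Δ`, `Δ'` and `X`, glued along `τ v ~ Z v` and `σ v ~ W
  -- v`.
  let R (s : S) (p q : Var Δ s ⊕ Var Δ' s ⊕ X s) : Prop :=
    (∃ v, p = .inl (τ s v) ∧ q = .inr (.inr (Z s v))) ∨
      ∃ v, p = .inr (.inl (σ s v)) ∧ q = .inr (.inr (W s v))
  have univ : ∀ {Y : S → Type _} (f : SMap (Var Δ) Y) (g : SMap (Var Δ') Y) (e : SMap X Y),
      f.comp τ = e.comp Z → g.comp σ = e.comp W →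
      ∀ s p q, R s p q → Sum.elim (f s) (Sum.elim (g s) (e s)) p =
        Sum.elim (f s) (Sum.elim (g s) (e s)) q := by
    rintro Y f g e hf hg s _ _ (⟨v, rfl, rfl⟩ | ⟨v, rfl, rfl⟩)
    · exact congrFun (congrFun hf s) v
    · exact congrFun (congrFun hg s) v
  -- Injectivity on `Δ` comes from a map out of the pushout that is `some` on `Δ`. On `X` it is
  -- `some ∘ τ` along `Z` and `none` elsewhere; on `Δ'` it exists because `e ∘ W` unifies `x'` and
  -- `y'` and `σ` is most general. `Option` makes the target non-empty. Exchanging the roles gives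
  -- injectivity on `Δ'`.
  have inj : ∀ {U V : S → Type u} {Δ Δ' : List S}, IsFinitary V →
      ∀ {Z : SMap U X} {W : SMap V X}, (∀ s, Function.Injective (Z s)) →
      ∀ {τ : SMap U (Var Δ)} {σ : SMap V (Var Δ')} {x y : Atom ar U} {x' y' : Atom ar V},
      IsMGU τ x y → IsMGU σ x' y' → x.map Z = x'.map W → y.map Z = y'.map W →
      ∃ (g : SMap (Var Δ') fun s => Option (Var Δ s)) (e : SMap X fun s => Option (Var Δ s)),
        SMap.comp (fun _ => some) τ = e.comp Z ∧ g.comp σ = e.comp W := by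
    intro U V Δ Δ' hV Z W hZ τ σ x y x' y' hτ hσ hx hy
    have key : ∀ s, ∃ e : X s → Option (Var Δ s), ∀ v, e (Z s v) = some (τ s v) := fun s =>
      ⟨Function.extend (Z s) (fun v => some (τ s v)) fun _ => none, fun v =>
        (hZ s).extend_apply ..⟩
    choose e he using key
    obtain ⟨g, hg⟩ := hσ.exists_comp_eq hV (Y := fun s => Option (Var Δ s)) (SMap.comp e W) (by
      funext p
      have h₁ : Z _ (x p) = W _ (x' p) := congrFun hx p
      have h₂ : Z _ (y p) = W _ (y' p) := congrFun hy p
      have h₃ : τ _ (x p) = τ _ (y p) := congrFun hτ.unifies p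
      simp only [Atom.map, SMap.comp, ← h₁, ← h₂, he, h₃])
    exact ⟨g, e, funext fun s => funext fun v => (he s v).symm, hg⟩
  refine ⟨fun s => Quot (R s), fun s v => Quot.mk _ (.inl v), fun s v => Quot.mk _ (.inr (.inl v)),
    fun s v => Quot.mk _ (.inr (.inr v)), ?_, ?_, ?_, ?_, ?_⟩
  · intro s v v' h
    obtain ⟨g, e, hf, hg⟩ := inj hV hZ hτ hσ hx hy
    exact Option.some.inj (congrArg (Quot.lift _ (univ _ g e hf hg s)) h)
  · intro s v v' h
    obtain ⟨f, e, hg, hf⟩ := inj hU hW hσ hτ hx.symm hy.symm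
    exact Option.some.inj (congrArg (Quot.lift _ (univ f _ e hf hg s)) h)
  · funext s v
    exact Quot.sound (.inl ⟨v, rfl, rfl⟩)
  · funext s v
    exact Quot.sound (.inr ⟨v, rfl, rfl⟩)
  · intro Y f g e hf hg
    refine ⟨fun s => Quot.lift (Sum.elim (f s) (Sum.elim (g s) (e s))) ?_, rfl, rfl⟩
    rintro _ _ (⟨v, rfl, rfl⟩ | ⟨v, rfl, rfl⟩)
    · exact congrFun (congrFun hf s) v
    · exact congrFun (congrFun hg s) v

end Unifiers

/-! ## Completeness of ground resolution -/

/-- A set of ground clauses that is closed under ordered resolution and factorization and does not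
contain the empty clause has a model. -/
theorem exists_model_of_closed {S : Type*} {ar : List S} {X : S → Type*} (𝒞 : Set (Cls ar X))
    (gt : Atom ar X → Atom ar X → Prop) (htrans : ∀ a b c, gt a b → gt b c → gt a c)
    (htotal : ∀ a b, a ≠ b → gt a b ∨ gt b a) (hwf : WellFounded fun a b => gt b a)
    (hres : ∀ a C D, .pos a ::ₘ C ∈ 𝒞 → .neg a ::ₘ D ∈ 𝒞 → (∀ l ∈ C, gt a l.atom) → C + D ∈ 𝒞)
    (hfact : ∀ a C, .pos a ::ₘ .pos a ::ₘ C ∈ 𝒞 → .neg a ∉ C → .pos a ::ₘ C ∈ 𝒞)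
    (hbot : (0 : Cls ar X) ∉ 𝒞) :
    ∃ I : Set (Atom ar X), ∀ C ∈ 𝒞, ∃ l ∈ C, l.Holds I := by
  classical
  obtain ⟨I, hI⟩ : ∃ I : Set (Atom ar X), ∀ a, a ∈ I ↔
      ∃ C, .pos a ::ₘ C ∈ 𝒞 ∧ ∀ l ∈ C, gt a l.atom ∧ ¬ l.Holds I := by
    -- Well-founded recursion: `a` is made true iff some clause `a ∨ C` needs it, that is, `C` lies
    -- below `a` and is false so far. Truth of `C` depends only on atoms below `a`, so it may be
    -- evaluated in the final `I`.
    let F (a : Atom ar X) (J : ∀ b, gt a b → Prop) : Prop :=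
      ∃ C, .pos a ::ₘ C ∈ 𝒞 ∧ ∀ l ∈ C, gt a l.atom ∧ ¬ l.Holds {b | ∃ h : gt a b, J b h}
    refine ⟨{a | hwf.fix F a}, fun a => ?_⟩
    rw [Set.mem_ofPred_eq, hwf.fix_eq]
    refine exists_congr fun C => and_congr_right fun _ => forall₂_congr fun l _ =>
      and_congr_right fun hl => not_congr ?_
    cases l with
    | pos b => exact ⟨fun ⟨_, h⟩ => h, fun h => ⟨hl, h⟩⟩
    | neg b => exact not_congr ⟨fun ⟨_, h⟩ => h, fun h => ⟨hl, h⟩⟩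
  -- Lexicographic induction on an upper bound `a` of the atoms of `C` and the number of occurrences
  -- of `a`.
  have main : ∀ a m, ∀ C ∈ 𝒞, (∀ l ∈ C, l.atom = a ∨ gt a l.atom) →
      C.countP (fun l => l.atom = a) = m → ∃ l ∈ C, l.Holds I := by
    intro a
    induction a using hwf.induction with
    | _ a iha =>
    intro m
    induction m using Nat.strong_induction_on with
    | _ m ihm =>
    intro C hC hle hm
    by_contra! hfalse
    -- If `¬a` is false, some clause `a ∨ B` made `a` true. The resolvent has one occurrence of `a`
    -- fewer, and `B` is false, so its true literal lies in `C`.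
    by_cases hneg : .neg a ∈ C
    · obtain ⟨D, rfl⟩ := Multiset.exists_cons_of_mem hneg
      have ha : a ∈ I := not_not.1 (hfalse _ hneg)
      obtain ⟨B, hB, hBl⟩ := (hI a).1 ha
      have hlt : (B + D).countP (fun l => l.atom = a) < m := by
        have h0 : B.countP (fun l => l.atom = a) = 0 := by
          refine Multiset.countP_eq_zero.2 fun l hl h => ?_
          have := (hBl l hl).1
          rw [h] at this
          exact hwf.irrefl.irrefl a this
        rw [Multiset.countP_add, h0, ← hm, Multiset.countP_cons_of_pos _ (by rfl)]
        omega
      obtain ⟨l, hl, hlI⟩ := ihm _ hlt (B + D) (hres a B D hB hC fun l hl => (hBl l hl).1)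
        (fun l hl => (Multiset.mem_add.1 hl).elim (fun h => .inr (hBl l h).1)
          fun h => hle l (Multiset.mem_cons_of_mem h)) rfl
      exact (Multiset.mem_add.1 hl).elim (fun h => (hBl l h).2 hlI)
        fun h => hfalse l (Multiset.mem_cons_of_mem h) hlI
    by_cases hpos : .pos a ∈ C
    · obtain ⟨D, rfl⟩ := Multiset.exists_cons_of_mem hpos
      by_cases hdup : .pos a ∈ D
      · obtain ⟨B, rfl⟩ := Multiset.exists_cons_of_mem hdup
        have hlt : (.pos a ::ₘ B : Cls ar X).countP (fun l => l.atom = a) < m := by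
          rw [← hm, Multiset.countP_cons_of_pos _ (by rfl),
            Multiset.countP_cons_of_pos (a := Lit.pos a) (Lit.pos a ::ₘ B) (by rfl),
            Multiset.countP_cons_of_pos _ (by rfl)]
          omega
        obtain ⟨l, hl, hlI⟩ := ihm _ hlt _ (hfact a B hC fun h =>
          hneg (Multiset.mem_cons_of_mem (Multiset.mem_cons_of_mem h)))
          (fun l hl => hle l (Multiset.mem_cons_of_mem hl)) rfl
        exact hfalse l (Multiset.mem_cons_of_mem hl) hlI
      -- With a single positive occurrence of `a` and no negative one, a false `C` would itself make
      -- `a` true.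
      · refine hfalse _ hpos ((hI a).2 ⟨D, hC, fun l hl => ⟨?_, ?_⟩⟩)
        · refine (hle l (Multiset.mem_cons_of_mem hl)).resolve_left fun h => ?_
          cases l with
          | pos b => exact hdup (by rwa [← (h : b = a)])
          | neg b => exact hneg (Multiset.mem_cons_of_mem (by rwa [← (h : b = a)]))
        · exact hfalse l (Multiset.mem_cons_of_mem hl)
    · have hlt : ∀ l ∈ C, gt a l.atom := fun l hl => (hle l hl).resolve_left fun h => by
        cases l with
        | pos b => exact hpos (by rwa [← (h : b = a)])
        | neg b => exact hneg (by rwa [← (h : b = a)])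
      have hne : C ≠ 0 := fun h => hbot (h ▸ hC)
      obtain ⟨l, hl, hmax⟩ := exists_max C hne
      obtain ⟨l', hl', h⟩ := iha l.atom (hlt l hl) _ C hC hmax rfl
      exact hfalse l' hl' h
  refine ⟨I, fun C hC => ?_⟩
  obtain ⟨l, hl, hmax⟩ := exists_max C fun h => hbot (h ▸ hC)
  exact main l.atom _ C hC hmax rfl
where
  exists_max (C : Cls ar X) (hC : C ≠ 0) :
      ∃ l ∈ C, ∀ l' ∈ C, l'.atom = l.atom ∨ gt l.atom l'.atom := by
    induction C using Multiset.induction_on with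
    | empty => exact absurd rfl hC
    | cons l C ih =>
      by_cases h0 : C = 0
      · subst h0
        exact ⟨l, by simp, by simp⟩
      · obtain ⟨m, hm, hmax⟩ := ih h0
        by_cases h : gt l.atom m.atom
        · refine ⟨l, by simp, fun l' hl' => ?_⟩
          rcases Multiset.mem_cons.1 hl' with rfl | hl'
          · exact .inl rfl
          · rcases hmax l' hl' with h' | h'
            · rw [h']
              exact .inr h
            · exact .inr (htrans _ _ _ h h')
        · refine ⟨m, Multiset.mem_cons_of_mem hm, fun l' hl' => ?_⟩
          rcases Multiset.mem_cons.1 hl' with rfl | hl'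
          · by_cases heq : l'.atom = m.atom
            · exact .inl heq
            · exact .inr ((htotal _ _ heq).resolve_left h)
          · exact hmax l' hl'

/-! ## Constrained Horn clauses -/

section Horn

variable {L : Sig.{u}} {ar : List L.Srt} {n k : ℕ} {N : Fin n → CClause L ar}
  {E : Fin k → PClause ar} {I : InferenceSet (clauses N E)} {A : Str.{u, w} L}

/-- Models of `CH_N`, spelled out. -/
structure IsCHModel (I : InferenceSet (clauses N E)) (M : MuInterp A (muCtx N E)) : Prop where
  base : ∀ (i : Fin n) (a : SMap (Var (N i).ctx) A.El), (N i).constr.Holds A a → a ∈ M (.inl i)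
  res : ∀ i j, ∀ s ∈ I.res i j, ∀ e : SMap (Var s.inf.ctx) A.El,
    e.comp s.inf.σ₁ ∈ M i → e.comp s.inf.σ₂ ∈ M j → e.comp s.z ∈ M s.k
  fact : ∀ i, ∀ s ∈ I.fact i, ∀ e : SMap (Var s.inf.ctx) A.El,
    e.comp s.inf.σ ∈ M i → e.comp s.z ∈ M s.k

theorem hornModels_CH_iff {M : MuInterp A (muCtx N E)} :
    HornModels A M (CH N E I) ↔ IsCHModel I M := by
  constructor
  · intro h
    refine ⟨fun i a ha => ?_, fun i j s hs e h₁ h₂ => ?_, fun i s hs e h₁ => ?_⟩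
    · obtain ⟨b, hb, hM⟩ := h _ (.inl (.inl ⟨i, rfl⟩)) a ha (by simp)
      cases hb
      exact hM
    · obtain ⟨b, hb, hM⟩ := h _ (.inl (.inr ⟨i, j, s, hs, rfl⟩)) e (Fm.holds_verum A e)
        (List.forall_mem_cons.2 ⟨h₁, List.forall_mem_singleton.2 h₂⟩)
      cases hb
      exact hM
    · obtain ⟨b, hb, hM⟩ := h _ (.inr ⟨i, s, hs, rfl⟩) e (Fm.holds_verum A e)
        (List.forall_mem_singleton.2 h₁)
      cases hb
      exact hM
  · rintro h _ ((⟨i, rfl⟩ | ⟨i, j, s, hs, rfl⟩) | ⟨i, s, hs, rfl⟩) e he hb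
    · exact ⟨_, rfl, h.base i e he⟩
    · exact ⟨_, rfl, h.res i j s hs e (hb ⟨i, s.inf.σ₁⟩ List.mem_cons_self)
        (hb ⟨j, s.inf.σ₂⟩ (List.mem_cons_of_mem _ List.mem_cons_self))⟩
    · exact ⟨_, rfl, h.fact i s hs e (hb ⟨i, s.inf.σ⟩ List.mem_cons_self)⟩

theorem hornModels_negMuBot_iff {M : MuInterp A (muCtx N E)} :
    HornModels A M (negMuBot N E) ↔ ∀ j, (clauses N E j).lits = 0 → ∀ a, a ∉ M j := by
  constructor
  · intro h j hj a ha
    obtain ⟨b, hb, -⟩ := h _ ⟨j, hj, rfl⟩ a (Fm.holds_verum A a)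
      (List.forall_mem_singleton.2 ha)
    cases hb
  · rintro h _ ⟨j, hj, rfl⟩ e he hb
    exact absurd (hb ⟨j, SMap.id _⟩ List.mem_cons_self) (h j hj e)

/-- The intersection of all models of `CH_N`. -/
def leastMu (I : InferenceSet (clauses N E)) (A : Str.{u, w} L) : MuInterp A (muCtx N E) :=
  fun i => {a | ∀ M : MuInterp A (muCtx N E), IsCHModel I M → a ∈ M i}

/-- Bodies are positive and each clause has a single head, so the conditions pass to intersections.
-/
theorem isCHModel_leastMu (I : InferenceSet (clauses N E)) (A : Str.{u, w} L) :
    IsCHModel I (leastMu I A) where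
  base i a ha _ hM := hM.base i a ha
  res i j s hs e h₁ h₂ M hM := hM.res i j s hs e (h₁ M hM) (h₂ M hM)
  fact i s hs e h₁ M hM := hM.fact i s hs e (h₁ M hM)

theorem IsCHModel.leastMu_subset {M : MuInterp A (muCtx N E)} (hM : IsCHModel I M) (i) :
    leastMu I A i ⊆ M i := fun _ ha => ha M hM

theorem isLeast_leastMu (I : InferenceSet (clauses N E)) (A : Str.{u, w} L) :
    IsLeast {M | HornModels A M (CH N E I)} (leastMu I A) :=
  ⟨hornModels_CH_iff.2 (isCHModel_leastMu I A),
    fun _ hM i => (hornModels_CH_iff.1 hM).leastMu_subset i⟩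

end Horn

/-! ## Soundness -/

section Soundness

variable {S : Type u} {ar : List S} {X : S → Type*}

theorem Resolution.concl_inst {c₁ c₂ : PClause ar} (r : Resolution c₁ c₂) (e : SMap (Var r.ctx) X) :
    r.concl.lits.inst e = r.C.inst (e.comp r.σ₁) + r.D.inst (e.comp r.σ₂) := by
  simp only [Resolution.concl, Cls.inst_add, Cls.inst_inst]

theorem Factorization.concl_inst {c : PClause ar} (r : Factorization c) (e : SMap (Var r.ctx) X) :
    r.concl.lits.inst e = .pos (r.x.map (e.comp r.σ)) ::ₘ r.C.inst (e.comp r.σ) := by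
  simp only [Factorization.concl, Cls.inst_inst, Cls.inst_cons, Lit.map]
  rfl

theorem Resolution.Valid.map_eq {gt : ∀ Γ : List S, Atom ar (Var Γ) → Atom ar (Var Γ) → Prop}
    {c₁ c₂ : PClause ar} {r : Resolution c₁ c₂} (h : r.Valid gt) (e : SMap (Var r.ctx) X) :
    r.x.map (e.comp r.σ₁) = r.y.map (e.comp r.σ₂) :=
  congrArg (Atom.map e) h.mgu.unifies

theorem Factorization.Valid.map_eq {gt : ∀ Γ : List S, Atom ar (Var Γ) → Atom ar (Var Γ) → Prop}
    {c : PClause ar} {r : Factorization c} (h : r.Valid gt) (e : SMap (Var r.ctx) X) :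
    r.x.map (e.comp r.σ) = r.y.map (e.comp r.σ) :=
  congrArg (Atom.map e) h.mgu.unifies

/-- Truth of a ground clause. -/
def Cls.True (J : Set (Atom ar X)) (C : Cls ar X) : Prop := ∃ l ∈ C, l.Holds J

theorem Cls.True.resolve {J : Set (Atom ar X)} {a : Atom ar X} {C D : Cls ar X}
    (h₁ : Cls.True J (.pos a ::ₘ C)) (h₂ : Cls.True J (.neg a ::ₘ D)) : Cls.True J (C + D) := by
  obtain ⟨l, hl, hJ⟩ := h₁
  obtain ⟨l', hl', hJ'⟩ := h₂
  rcases Multiset.mem_cons.1 hl with rfl | hl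
  · rcases Multiset.mem_cons.1 hl' with rfl | hl'
    · exact absurd hJ hJ'
    · exact ⟨l', Multiset.mem_add.2 (.inr hl'), hJ'⟩
  · exact ⟨l, Multiset.mem_add.2 (.inl hl), hJ⟩

theorem Cls.True.factor {J : Set (Atom ar X)} {a : Atom ar X} {C : Cls ar X}
    (h : Cls.True J (.pos a ::ₘ .pos a ::ₘ C)) : Cls.True J (.pos a ::ₘ C) := by
  obtain ⟨l, hl, hJ⟩ := h
  rcases Multiset.mem_cons.1 hl with rfl | hl
  · exact ⟨_, Multiset.mem_cons_self _ _, hJ⟩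
  · exact ⟨l, hl, hJ⟩

/-- The instance of the first premise of a resolution inference. -/
theorem Resolution.Valid.inst₁ {gt : ∀ Γ : List S, Atom ar (Var Γ) → Atom ar (Var Γ) → Prop}
    {c₁ c₂ : PClause ar} {r : Resolution c₁ c₂} (h : r.Valid gt) (e : SMap (Var r.ctx) X) :
    c₁.lits.inst (e.comp r.σ₁) = .pos (r.x.map (e.comp r.σ₁)) ::ₘ r.C.inst (e.comp r.σ₁) := by
  rw [h.prem₁, Cls.inst_cons, Lit.map]

/-- The instance of the second premise of a resolution inference. -/
theorem Resolution.Valid.inst₂ {gt : ∀ Γ : List S, Atom ar (Var Γ) → Atom ar (Var Γ) → Prop}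
    {c₁ c₂ : PClause ar} {r : Resolution c₁ c₂} (h : r.Valid gt) (e : SMap (Var r.ctx) X) :
    c₂.lits.inst (e.comp r.σ₂) = .neg (r.x.map (e.comp r.σ₁)) ::ₘ r.D.inst (e.comp r.σ₂) := by
  rw [h.prem₂, Cls.inst_cons, Lit.map, h.map_eq]

/-- The instance of the premise of a factorization inference. -/
theorem Factorization.Valid.inst {gt : ∀ Γ : List S, Atom ar (Var Γ) → Atom ar (Var Γ) → Prop}
    {c : PClause ar} {r : Factorization c} (h : r.Valid gt) (e : SMap (Var r.ctx) X) :
    c.lits.inst (e.comp r.σ) = .pos (r.x.map (e.comp r.σ)) ::ₘ .pos (r.x.map (e.comp r.σ)) ::ₘ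
      r.C.inst (e.comp r.σ) := by
  rw [h.prem, Cls.inst_cons, Cls.inst_cons, Lit.map, Lit.map, ← h.map_eq]

theorem IsVariantVia.inst_comp {c d : PClause ar} {z : SMap (Var c.ctx) (Var d.ctx)}
    (h : IsVariantVia c d z) (e : SMap (Var d.ctx) X) :
    c.lits.inst (e.comp z) = d.lits.inst e := by
  rw [← h.2, Cls.inst_inst]

theorem ResInf.inst_comp {ι : Type} {C : ι → PClause ar} {i j : ι} (s : ResInf C i j)
    (h : IsVariantVia (C s.k) s.inf.concl s.z) (e : SMap (Var s.inf.ctx) X) :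
    (C s.k).lits.inst (e.comp s.z) =
      s.inf.C.inst (e.comp s.inf.σ₁) + s.inf.D.inst (e.comp s.inf.σ₂) := by
  rw [← s.inf.concl_inst]
  exact h.inst_comp e

theorem FactInf.inst_comp {ι : Type} {C : ι → PClause ar} {i : ι} (s : FactInf C i)
    (h : IsVariantVia (C s.k) s.inf.concl s.z) (e : SMap (Var s.inf.ctx) X) :
    (C s.k).lits.inst (e.comp s.z) =
      .pos (s.inf.x.map (e.comp s.inf.σ)) ::ₘ s.inf.C.inst (e.comp s.inf.σ) := by
  rw [← s.inf.concl_inst]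
  exact h.inst_comp e

end Soundness

/-! ### Soundness over a structure, for constrained clauses and for `CH_N` -/

section Horn

variable {L : Sig.{u}} {ar : List L.Srt} {n k : ℕ} {N : Fin n → CClause L ar}
  {E : Fin k → PClause ar} {I : InferenceSet (clauses N E)} {A : Str.{u, w} L}
  {gt : ∀ Γ : List L.Srt, Atom ar (Var Γ) → Atom ar (Var Γ) → Prop}

/-- Resolution of constrained clauses is sound. -/
theorem HRes.sound {𝒩 : Set (CClause L ar)} {J : Set (Atom ar A.El)}
    (hJ : ∀ c ∈ 𝒩, ∀ e : SMap (Var c.ctx) A.El, c.constr.Holds A e → (c.lits.inst e).True J)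
    {c : CClause L ar} (hc : HRes gt 𝒩 c) (e : SMap (Var c.ctx) A.El) (he : c.constr.Holds A e) :
    (c.lits.inst e).True J := by
  induction hc with
  | base c hc => exact hJ c hc e he
  | res c₁ c₂ r _ _ hr ih₁ ih₂ =>
    change SMap (Var r.ctx) A.El at e
    obtain ⟨he₁, he₂⟩ := (Fm.holds_and (Γ := r.ctx) A _ _ e).1 he
    have h₁ := ih₁ _ ((Fm.holds_subst A r.σ₁ e _).1 he₁)
    have h₂ := ih₂ _ ((Fm.holds_subst A r.σ₂ e _).1 he₂)
    rw [hr.inst₁] at h₁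
    rw [hr.inst₂] at h₂
    have h := h₁.resolve h₂
    rwa [← r.concl_inst e] at h
  | fact c r _ hr ih =>
    change SMap (Var r.ctx) A.El at e
    have h := ih _ ((Fm.holds_subst A r.σ e _).1 he)
    rw [hr.inst] at h
    have h' := h.factor
    rwa [← r.concl_inst e] at h'

/-- An interpretation of `P` that satisfies `N` yields a model of `CH_N`. -/
theorem isCHModel_of_true (hsat : IsFiniteSaturation gt N E I) {J : Set (Atom ar A.El)}
    (hJ : ∀ c ∈ Set.range N, ∀ e : SMap (Var c.ctx) A.El, c.constr.Holds A e →
      (c.lits.inst e).True J) :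
    IsCHModel I (fun i => {a | ((clauses N E i).lits.inst a).True J} :
      MuInterp A (muCtx N E)) where
  base i a ha := hJ _ ⟨i, rfl⟩ a ha
  res i j s hs e h₁ h₂ := by
    obtain ⟨hv, hz⟩ := hsat.res_valid i j s hs
    rw [Set.mem_ofPred_eq, hv.inst₁] at h₁
    rw [Set.mem_ofPred_eq, hv.inst₂] at h₂
    rw [Set.mem_ofPred_eq, s.inst_comp hz]
    exact h₁.resolve h₂
  fact i s hs e h := by
    obtain ⟨hv, hz⟩ := hsat.fact_valid i s hs
    rw [Set.mem_ofPred_eq, hv.inst] at h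
    rw [Set.mem_ofPred_eq, s.inst_comp hz]
    exact h.factor

/-- The clauses `μ_i(a) ∥ C_i(a)` with `μ_i(a)` true are derivable from the instances of `N`. -/
theorem exists_gDerivable (hsat : IsFiniteSaturation gt N E I) (M : MuInterp A (muCtx N E)) {i}
    {a : SMap (Var (muCtx N E i)) A.El} (ha : a ∈ leastMu I A i) :
    ∃ ξ, GDerivable (groundN A N E) ⟨ξ, (clauses N E i).lits.inst a⟩ ∧ ξ.Holds M := by
  -- Minimality replaces an induction on the least model: the tuples with the claimed property form
  -- a model of `CH_N`.
  refine IsCHModel.leastMu_subset (M := fun i => {a | ∃ ξ, GDerivable (groundN A N E)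
    ⟨ξ, (clauses N E i).lits.inst a⟩ ∧ ξ.Holds M}) ⟨?_, ?_, ?_⟩ i ha
  · exact fun i a ha => ⟨_, .base _ ⟨i, a, rfl⟩, ha⟩
  · rintro i j s hs e ⟨ξ₁, h₁, hξ₁⟩ ⟨ξ₂, h₂, hξ₂⟩
    obtain ⟨hv, hz⟩ := hsat.res_valid i j s hs
    rw [hv.inst₁] at h₁
    rw [hv.inst₂] at h₂
    refine ⟨ξ₁.and ξ₂, ?_, hξ₁, hξ₂⟩
    rw [s.inst_comp hz]
    exact .res _ _ _ _ _ h₁ h₂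
  · rintro i s hs e ⟨ξ, h, hξ⟩
    obtain ⟨hv, hz⟩ := hsat.fact_valid i s hs
    rw [hv.inst] at h
    refine ⟨ξ, ?_, hξ⟩
    rw [s.inst_comp hz]
    exact .fact _ _ _ h

end Horn

/-! ## Existence of inferences -/

section Inferences

variable {S : Type u} {ar : List S} {gt : ∀ Γ : List S, Atom ar (Var Γ) → Atom ar (Var Γ) → Prop}

/-- The map on renamed apart variables that is given by maps on the two sets of variables. -/
def Apart.elim {Γ₁ Γ₂ : List S} {Y : S → Type*} (e₁ : SMap (Var Γ₁) Y) (e₂ : SMap (Var Γ₂) Y) :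
    SMap (Apart Γ₁ Γ₂) Y := fun s => Sum.elim (e₁ s) (e₂ s)

/-- With `gt` empty, the only obstruction is a literal of `C` acquiring the resolved atom under the
most general unifier. It would then acquire it under the given unifier `e₁`, `e₂` too, against
`hmax`. The values lie in an arbitrary family, so that both elements of a structure and pushouts of
variables are covered. -/
theorem exists_resolution (hgt : IsStableOrder gt) {c₁ c₂ : PClause ar} {x : Atom ar (Var c₁.ctx)}
    {C : Cls ar (Var c₁.ctx)} {y : Atom ar (Var c₂.ctx)} {D : Cls ar (Var c₂.ctx)}
    (h₁ : c₁.lits = .pos x ::ₘ C) (h₂ : c₂.lits = .neg y ::ₘ D) {Y : S → Type*}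
    (e₁ : SMap (Var c₁.ctx) Y) (e₂ : SMap (Var c₂.ctx) Y) (hxy : x.map e₁ = y.map e₂)
    (hmax : ∀ l ∈ C, l.atom.map e₁ ≠ x.map e₁) :
    ∃ r : Resolution c₁ c₂, r.Valid gt ∧ r.x = x ∧ r.C = C ∧ r.y = y ∧ r.D = D := by
  obtain ⟨Δ, σ, hσ⟩ := exists_isMGU (isFinitary_apart c₁.ctx c₂.ctx)
    (x.map (Apart.fst _ _)) (y.map (Apart.snd _ _))
  let r : Resolution c₁ c₂ := ⟨x, C, y, D, Δ, σ⟩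
  have hne : ∀ l ∈ C, l.atom.map r.σ₁ ≠ x.map r.σ₁ := fun l hl h => hmax l hl <| funext fun p =>
    hσ.eq_of_eq (isFinitary_apart ..) (Apart.elim e₁ e₂) hxy (congrFun h p)
  refine ⟨r, ⟨h₁, h₂, hσ, fun l' hl' => ?_, ?_⟩, rfl, rfl, rfl, rfl⟩
  · obtain ⟨l, hl, rfl⟩ := Cls.mem_inst.1 hl'
    refine ⟨?_, fun h => hne l hl ?_⟩
    · rintro (h | ⟨a, ha, ha'⟩)
      · exact hgt.not_gt _ _ h
      · refine hne l hl ?_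
        rw [← Lit.atom_map, ha]
        exact (Lit.pos.inj ha').symm
    · rw [← Lit.atom_map, h]
      rfl
  -- Over a given atom the negative literal is the largest, so its maximality is automatic.
  · rintro l - (h | ⟨a, -, ha⟩)
    · exact hgt.not_gt _ _ h
    · cases ha

/-- Only the negative literal over the unified atom could exceed the positive one; if it occurred
after most general unification, it would occur in the instance under `e`. -/
theorem exists_factorization (hgt : IsStableOrder gt) {c : PClause ar} {x y : Atom ar (Var c.ctx)}
    {C : Cls ar (Var c.ctx)} (h : c.lits = .pos x ::ₘ .pos y ::ₘ C) {Y : S → Type*}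
    (e : SMap (Var c.ctx) Y) (hxy : x.map e = y.map e) (hmax : .neg (x.map e) ∉ C.inst e) :
    ∃ r : Factorization c, r.Valid gt ∧ r.x = x ∧ r.y = y ∧ r.C = C := by
  obtain ⟨Δ, σ, hσ⟩ := exists_isMGU (isFinitary_var c.ctx) x y
  refine ⟨⟨x, y, C, Δ, σ⟩, ⟨h, hσ, fun l' hl' => ?_⟩, rfl, rfl, rfl⟩
  obtain ⟨l, hl, rfl⟩ := Cls.mem_inst.1 hl'
  rintro (h | ⟨a, ha, ha'⟩)
  · exact hgt.not_gt _ _ h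
  · cases Lit.pos.inj ha'
    obtain ⟨b, rfl, hb⟩ := Lit.map_eq_neg ha
    refine hmax (Cls.mem_inst.2 ⟨_, hl, congrArg Lit.neg (funext fun p => ?_)⟩)
    exact hσ.eq_of_eq (isFinitary_var _) e hxy (congrFun hb p)

/-- A literal over the resolved atom would equal the resolved literal if positive and exceed it if
negative. -/
theorem Resolution.Valid.atom_ne {c₁ c₂ : PClause ar} {r : Resolution c₁ c₂} (hr : r.Valid gt)
    {l : Lit ar (Var c₁.ctx)} (hl : l ∈ r.C) : l.atom.map r.σ₁ ≠ r.x.map r.σ₁ := by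
  intro h
  obtain ⟨h₁, h₂⟩ := hr.max₁ _ (Cls.mem_inst.2 ⟨l, hl, rfl⟩)
  cases l with
  | pos a => exact h₂ (congrArg Lit.pos h)
  | neg a => exact h₁ (.inr ⟨_, rfl, congrArg Lit.pos h.symm⟩)

theorem Factorization.Valid.neg_notMem {c : PClause ar} {r : Factorization c} (hr : r.Valid gt) :
    .neg (r.x.map r.σ) ∉ r.C.inst r.σ := fun h => hr.max _ h (.inr ⟨_, rfl, rfl⟩)

theorem Resolution.Valid.exists_comp_eq {c₁ c₂ : PClause ar} {r : Resolution c₁ c₂}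
    (hr : r.Valid gt) {Y : S → Type*} [∀ s, Nonempty (Y s)] {e₁ : SMap (Var c₁.ctx) Y}
    {e₂ : SMap (Var c₂.ctx) Y} (h : r.x.map e₁ = r.y.map e₂) :
    ∃ e : SMap (Var r.ctx) Y, e.comp r.σ₁ = e₁ ∧ e.comp r.σ₂ = e₂ := by
  obtain ⟨e, he⟩ := hr.mgu.exists_comp_eq (isFinitary_apart ..) (Apart.elim e₁ e₂) h
  exact ⟨e, congrArg (SMap.comp · (Apart.fst _ _)) he, congrArg (SMap.comp · (Apart.snd _ _)) he⟩

theorem Factorization.Valid.exists_comp_eq {c : PClause ar} {r : Factorization c}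
    (hr : r.Valid gt) {Y : S → Type*} [∀ s, Nonempty (Y s)] {e : SMap (Var c.ctx) Y}
    (h : r.x.map e = r.y.map e) : ∃ e' : SMap (Var r.ctx) Y, e'.comp r.σ = e :=
  hr.mgu.exists_comp_eq (isFinitary_var _) e h

end Inferences

/-! ## Inferences between variants -/

section Variants

variable {S : Type u} {ar : List S} {gt : ∀ Γ : List S, Atom ar (Var Γ) → Atom ar (Var Γ) → Prop}

/-- A witness for `c` and `d` being equal up to renaming: their variables are embedded into a
common family, in which the clauses coincide. As the contexts may contain unused variables, there
need not be a renaming from one context to the other. -/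
structure CommonVariant (c d : PClause ar) where
  X : S → Type u
  l : SMap (Var c.ctx) X
  r : SMap (Var d.ctx) X
  l_injective : ∀ s, Function.Injective (l s)
  r_injective : ∀ s, Function.Injective (r s)
  inst_eq : c.lits.inst l = d.lits.inst r

namespace CommonVariant

variable {c d : PClause ar} {Y : S → Type*}

def refl (c : PClause ar) : CommonVariant c c :=
  ⟨Var c.ctx, SMap.id _, SMap.id _, fun _ _ _ h => h, fun _ _ _ h => h, rfl⟩

def symm (v : CommonVariant c d) : CommonVariant d c :=
  ⟨v.X, v.r, v.l, v.r_injective, v.l_injective, v.inst_eq.symm⟩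

def transVariant (v : CommonVariant c d) {d' : PClause ar} {z : SMap (Var d'.ctx) (Var d.ctx)}
    (h : IsVariantVia d' d z) : CommonVariant c d' :=
  ⟨v.X, v.l, v.r.comp z, v.l_injective, fun s => (v.r_injective s).comp (h.1 s),
    v.inst_eq.trans (h.inst_comp v.r).symm⟩

/-- Valuations of the variables of `c` and of `d` that agree on corresponding variables. -/
def Agree (v : CommonVariant c d) (e : SMap (Var c.ctx) Y) (f : SMap (Var d.ctx) Y) : Prop :=
  ∃ h : SMap v.X Y, h.comp v.l = e ∧ h.comp v.r = f

theorem Agree.symm {v : CommonVariant c d} {e : SMap (Var c.ctx) Y} {f : SMap (Var d.ctx) Y}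
    (h : v.Agree e f) : v.symm.Agree f e := h.imp fun _ => And.symm

theorem Agree.transVariant {v : CommonVariant c d} {e : SMap (Var c.ctx) Y}
    {f : SMap (Var d.ctx) Y} (h : v.Agree e f) {d' : PClause ar}
    {z : SMap (Var d'.ctx) (Var d.ctx)} (hz : IsVariantVia d' d z) :
    (v.transVariant hz).Agree e (f.comp z) := by
  obtain ⟨h, rfl, rfl⟩ := h
  exact ⟨h, rfl, rfl⟩

theorem Agree.inst_eq {v : CommonVariant c d} {e : SMap (Var c.ctx) Y} {f : SMap (Var d.ctx) Y}
    (h : v.Agree e f) : c.lits.inst e = d.lits.inst f := by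
  obtain ⟨h, rfl, rfl⟩ := h
  rw [← Cls.inst_inst, ← Cls.inst_inst, v.inst_eq]

theorem Agree.map_eq {v : CommonVariant c d} {e : SMap (Var c.ctx) Y} {f : SMap (Var d.ctx) Y}
    (h : v.Agree e f) {x : Atom ar (Var c.ctx)} {y : Atom ar (Var d.ctx)}
    (hxy : x.map v.l = y.map v.r) : x.map e = y.map f := by
  obtain ⟨h, rfl, rfl⟩ := h
  exact congrArg (Atom.map h) hxy

end CommonVariant

/-- Resolution inferences between clauses `c₁`, `c₂` and between their variants `d₁`, `d₂` that
resolve on corresponding literals. -/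
structure Resolution.Corresponds {c₁ c₂ d₁ d₂ : PClause ar} (v₁ : CommonVariant c₁ d₁)
    (v₂ : CommonVariant c₂ d₂) (r : Resolution c₁ c₂) (r' : Resolution d₁ d₂) : Prop where
  x : r.x.map v₁.l = r'.x.map v₁.r
  C : r.C.inst v₁.l = r'.C.inst v₁.r
  y : r.y.map v₂.l = r'.y.map v₂.r
  D : r.D.inst v₂.l = r'.D.inst v₂.r

/-- Factorization inferences from a clause `c` and from a variant `d` that unify corresponding
literals. -/
structure Factorization.Corresponds {c d : PClause ar} (v : CommonVariant c d)
    (r : Factorization c) (r' : Factorization d) : Prop where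
  x : r.x.map v.l = r'.x.map v.r
  y : r.y.map v.l = r'.y.map v.r
  C : r.C.inst v.l = r'.C.inst v.r

/-! ### Resolution inferences between variants -/

section

variable {c₁ c₂ d₁ d₂ : PClause ar} {v₁ : CommonVariant c₁ d₁} {v₂ : CommonVariant c₂ d₂}
  {r : Resolution c₁ c₂} {r' : Resolution d₁ d₂}

theorem Resolution.Corresponds.symm (h : r.Corresponds v₁ v₂ r') :
    r'.Corresponds v₁.symm v₂.symm r := ⟨h.x.symm, h.C.symm, h.y.symm, h.D.symm⟩

/-- The embeddings of the variables of two clauses, renamed apart. -/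
def CommonVariant.sumL (v₁ : CommonVariant c₁ d₁) (v₂ : CommonVariant c₂ d₂) :
    SMap (Apart c₁.ctx c₂.ctx) fun s => v₁.X s ⊕ v₂.X s := fun s => Sum.map (v₁.l s) (v₂.l s)

theorem CommonVariant.sumL_injective (v₁ : CommonVariant c₁ d₁) (v₂ : CommonVariant c₂ d₂) (s : S) :
    Function.Injective (v₁.sumL v₂ s) := (v₁.l_injective s).sumMap (v₂.l_injective s)

theorem CommonVariant.map_fst_sumL {x : Atom ar (Var c₁.ctx)} {x' : Atom ar (Var d₁.ctx)}
    (h : x.map v₁.l = x'.map v₁.r) :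
    Atom.map (v₁.sumL v₂) (x.map (Apart.fst _ _)) =
      Atom.map (v₁.symm.sumL v₂.symm) (x'.map (Apart.fst _ _)) :=
  congrArg (Atom.map (fun _ => Sum.inl : SMap v₁.X fun s => v₁.X s ⊕ v₂.X s)) h

theorem CommonVariant.map_snd_sumL {x : Atom ar (Var c₂.ctx)} {x' : Atom ar (Var d₂.ctx)}
    (h : x.map v₂.l = x'.map v₂.r) :
    Atom.map (v₁.sumL v₂) (x.map (Apart.snd _ _)) =
      Atom.map (v₁.symm.sumL v₂.symm) (x'.map (Apart.snd _ _)) :=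
  congrArg (Atom.map (fun _ => Sum.inr : SMap v₂.X fun s => v₁.X s ⊕ v₂.X s)) h

/-- Corresponding literals are found by matching the clauses in the common family. The pushout
compares the two most general unifiers: a collision of atoms on the side of `d₁` becomes one in the
pushout, and injectivity of `z` turns it into a collision excluded by validity of `r`. -/
theorem Resolution.Valid.exists_corresponds (hgt : IsStableOrder gt) (hr : r.Valid gt)
    (v₁ : CommonVariant c₁ d₁) (v₂ : CommonVariant c₂ d₂) :
    ∃ r' : Resolution d₁ d₂, r'.Valid gt ∧ r.Corresponds v₁ v₂ r' := by
  have h₁ := v₁.inst_eq.symm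
  rw [hr.prem₁, Cls.inst_cons, Lit.map] at h₁
  obtain ⟨x, C, hd₁, hx, hC⟩ := Cls.inst_eq_pos_cons h₁
  have h₂ := v₂.inst_eq.symm
  rw [hr.prem₂, Cls.inst_cons, Lit.map] at h₂
  obtain ⟨y, D, hd₂, hy, hD⟩ := Cls.inst_eq_neg_cons h₂
  obtain ⟨Δ, τ, hτ⟩ := exists_isMGU (isFinitary_apart d₁.ctx d₂.ctx)
    (x.map (Apart.fst _ _)) (y.map (Apart.snd _ _))
  obtain ⟨X', z, w, h, hz, -, hzσ, hwτ, -⟩ := IsMGU.exists_pushout.{u, 0} (isFinitary_apart ..)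
    (isFinitary_apart ..) (v₁.sumL_injective v₂) (v₁.symm.sumL_injective v₂.symm) hr.mgu hτ
    (CommonVariant.map_fst_sumL hx.symm) (CommonVariant.map_snd_sumL hy.symm)
  let g : SMap v₁.X X' := fun s v => h s (.inl v)
  have hg : g.comp v₁.l = z.comp r.σ₁ := congrArg (SMap.comp · (Apart.fst _ _)) hzσ.symm
  obtain ⟨r', hr', rfl, rfl, rfl, rfl⟩ := exists_resolution hgt hd₁ hd₂
    (w.comp (τ.comp (Apart.fst _ _))) (w.comp (τ.comp (Apart.snd _ _)))
    (congrArg (Atom.map w) hτ.unifies) (by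
      intro l hl hne
      have hw : w.comp (τ.comp (Apart.fst _ _)) = g.comp v₁.r :=
        congrArg (SMap.comp · (Apart.fst _ _)) hwτ
      rw [hw] at hne
      obtain ⟨l', hl', hll⟩ := Cls.mem_inst.1 (hC ▸ Cls.mem_inst.2 ⟨l, hl, rfl⟩)
      refine hr.atom_ne hl' (Atom.map_injective hz ?_)
      change l'.atom.map (z.comp r.σ₁) = r.x.map (z.comp r.σ₁)
      rw [← hg]
      change Atom.map g (l'.atom.map v₁.l) = Atom.map g (r.x.map v₁.l)
      rw [← Lit.atom_map, hll, ← hx, Lit.atom_map]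
      exact hne)
  exact ⟨r', hr', hx.symm, hC.symm, hy.symm, hD.symm⟩

/-- The pushout of the two unifiers serves as the common family of the conclusions; its universal
property glues agreement on the two premises into agreement on the conclusions. -/
theorem Resolution.Corresponds.exists_commonVariant (h : r.Corresponds v₁ v₂ r')
    (hr : r.Valid gt) (hr' : r'.Valid gt) :
    ∃ v : CommonVariant r.concl r'.concl, ∀ (Y : S → Type w) (e : SMap (Var r.ctx) Y)
      (e' : SMap (Var r'.ctx) Y), v₁.Agree (e.comp r.σ₁) (e'.comp r'.σ₁) →
      v₂.Agree (e.comp r.σ₂) (e'.comp r'.σ₂) → v.Agree e e' := by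
  obtain ⟨X', z, w, g, hz, hw, hzσ, hwτ, huniv⟩ := hr.mgu.exists_pushout (isFinitary_apart ..)
    (isFinitary_apart ..) (v₁.sumL_injective v₂) (v₁.symm.sumL_injective v₂.symm) hr'.mgu
    (CommonVariant.map_fst_sumL h.x) (CommonVariant.map_snd_sumL h.y)
  let g₁ : SMap v₁.X X' := fun s v => g s (.inl v)
  let g₂ : SMap v₂.X X' := fun s v => g s (.inr v)
  have hl₁ : z.comp r.σ₁ = g₁.comp v₁.l := congrArg (SMap.comp · (Apart.fst _ _)) hzσ
  have hl₂ : z.comp r.σ₂ = g₂.comp v₂.l := congrArg (SMap.comp · (Apart.snd _ _)) hzσ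
  have hr₁ : w.comp r'.σ₁ = g₁.comp v₁.r := congrArg (SMap.comp · (Apart.fst _ _)) hwτ
  have hr₂ : w.comp r'.σ₂ = g₂.comp v₂.r := congrArg (SMap.comp · (Apart.snd _ _)) hwτ
  refine ⟨⟨X', z, w, hz, hw, ?_⟩, ?_⟩
  · refine (r.concl_inst z).trans (Eq.trans ?_ (r'.concl_inst w).symm)
    rw [hl₁, hl₂, hr₁, hr₂, ← Cls.inst_inst, ← Cls.inst_inst, ← Cls.inst_inst, ← Cls.inst_inst,
      h.C, h.D]
  · rintro Y e e' ⟨f₁, hf₁, hf₁'⟩ ⟨f₂, hf₂, hf₂'⟩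
    refine huniv Y e e' (fun s => Sum.elim (f₁ s) (f₂ s)) ?_ ?_
    · funext s v
      rcases v with v | v
      · exact (congrFun (congrFun hf₁ s) v).symm
      · exact (congrFun (congrFun hf₂ s) v).symm
    · funext s v
      rcases v with v | v
      · exact (congrFun (congrFun hf₁' s) v).symm
      · exact (congrFun (congrFun hf₂' s) v).symm

end

/-! ### Factorization inferences between variants -/

section

variable {c d : PClause ar} {v : CommonVariant c d} {r : Factorization c} {r' : Factorization d}

theorem Factorization.Corresponds.symm (h : r.Corresponds v r') : r'.Corresponds v.symm r :=
  ⟨h.x.symm, h.y.symm, h.C.symm⟩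

theorem Factorization.Valid.exists_corresponds (hgt : IsStableOrder gt) (hr : r.Valid gt)
    (v : CommonVariant c d) : ∃ r' : Factorization d, r'.Valid gt ∧ r.Corresponds v r' := by
  have h₁ := v.inst_eq.symm
  rw [hr.prem, Cls.inst_cons, Cls.inst_cons, Lit.map, Lit.map] at h₁
  obtain ⟨x, C', hd, hx, hC'⟩ := Cls.inst_eq_pos_cons h₁
  obtain ⟨y, C, rfl, hy, hC⟩ := Cls.inst_eq_pos_cons hC'
  obtain ⟨Δ, τ, hτ⟩ := exists_isMGU (isFinitary_var d.ctx) x y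
  obtain ⟨X', z, w, g, hz, -, hzσ, hwτ, -⟩ := IsMGU.exists_pushout.{u, 0} (isFinitary_var _)
    (isFinitary_var _) v.l_injective v.r_injective hr.mgu hτ hx.symm hy.symm
  obtain ⟨r', hr', rfl, rfl, rfl⟩ := exists_factorization hgt hd (w.comp τ)
    (congrArg (Atom.map w) hτ.unifies) (by
      rw [hwτ, ← Cls.inst_inst, hC, Cls.inst_inst, ← hzσ, ← Cls.inst_inst]
      intro hmem
      obtain ⟨l, hl, hlx⟩ := Cls.mem_inst.1 hmem
      have hxz : x.map (g.comp v.r) = Atom.map z (r.x.map r.σ) := by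
        change Atom.map g (x.map v.r) = r.x.map (z.comp r.σ)
        rw [hx, hzσ]
        rfl
      rw [hxz] at hlx
      exact hr.neg_notMem (Lit.map_injective hz (a₂ := .neg (r.x.map r.σ)) hlx ▸ hl))
  exact ⟨r', hr', hx.symm, hy.symm, hC.symm⟩

theorem Factorization.Corresponds.exists_commonVariant (h : r.Corresponds v r')
    (hr : r.Valid gt) (hr' : r'.Valid gt) :
    ∃ v' : CommonVariant r.concl r'.concl, ∀ (Y : S → Type w) (e : SMap (Var r.ctx) Y)
      (e' : SMap (Var r'.ctx) Y), v.Agree (e.comp r.σ) (e'.comp r'.σ) → v'.Agree e e' := by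
  obtain ⟨X', z, w, g, hz, hw, hzσ, hwτ, huniv⟩ := hr.mgu.exists_pushout (isFinitary_var _)
    (isFinitary_var _) v.l_injective v.r_injective hr'.mgu h.x h.y
  refine ⟨⟨X', z, w, hz, hw, ?_⟩, ?_⟩
  · refine (r.concl_inst z).trans (Eq.trans ?_ (r'.concl_inst w).symm)
    rw [hzσ, hwτ, ← Cls.inst_inst, ← Cls.inst_inst, h.C]
    congr 2
    exact congrArg (Atom.map g) h.x
  · rintro Y e e' ⟨f, hf, hf'⟩
    exact huniv Y e e' f hf.symm hf'.symm

end

end Variants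

/-! ## Ground inferences between instances of a saturated set of clauses -/

section Saturation

variable {L : Sig.{u}} {ar : List L.Srt} {n k : ℕ} {N : Fin n → CClause L ar}
  {E : Fin k → PClause ar} {I : InferenceSet (clauses N E)} {A : Str.{u, w} L}
  {gt : ∀ Γ : List L.Srt, Atom ar (Var Γ) → Atom ar (Var Γ) → Prop}

/-- Completeness only promises the same resolved atoms; the side clauses then agree by cancellation
in the premises. -/
theorem IsFiniteSaturation.exists_res (hsat : IsFiniteSaturation gt N E I) {i j}
    {r : Resolution (clauses N E i) (clauses N E j)} (hr : r.Valid gt) :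
    ∃ s ∈ I.res i j, s.inf.Valid gt ∧ s.inf.x = r.x ∧ s.inf.C = r.C ∧ s.inf.y = r.y ∧
      s.inf.D = r.D := by
  obtain ⟨s, hs, hx, hy⟩ := hsat.res_complete i j r hr
  have hv := (hsat.res_valid i j s hs).1
  refine ⟨s, hs, hv, hx, ?_, hy, ?_⟩
  · have := hv.prem₁.symm.trans hr.prem₁
    rwa [hx, Multiset.cons_inj_right] at this
  · have := hv.prem₂.symm.trans hr.prem₂
    rwa [hy, Multiset.cons_inj_right] at this

theorem IsFiniteSaturation.exists_fact (hsat : IsFiniteSaturation gt N E I) {i}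
    {r : Factorization (clauses N E i)} (hr : r.Valid gt) :
    ∃ s ∈ I.fact i, s.inf.Valid gt ∧ s.inf.x = r.x ∧ s.inf.y = r.y ∧ s.inf.C = r.C := by
  obtain ⟨s, hs, hx, hy⟩ := hsat.fact_complete i r hr
  have hv := (hsat.fact_valid i s hs).1
  refine ⟨s, hs, hv, hx, hy, ?_⟩
  have := hv.prem.symm.trans hr.prem
  rwa [hx, hy, Multiset.cons_inj_right, Multiset.cons_inj_right] at this

/-- Lifting of ground resolution. -/
theorem IsCHModel.exists_resolvent (hgt : IsStableOrder gt) (hsat : IsFiniteSaturation gt N E I)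
    {M : MuInterp A (muCtx N E)} (hM : IsCHModel I M) {i j} {e₁ : SMap (Var (muCtx N E i)) A.El}
    {e₂ : SMap (Var (muCtx N E j)) A.El} {a : Atom ar A.El} {C D : Cls ar A.El}
    (h₁ : (clauses N E i).lits.inst e₁ = .pos a ::ₘ C)
    (h₂ : (clauses N E j).lits.inst e₂ = .neg a ::ₘ D) (hmax : ∀ l ∈ C, l.atom ≠ a) :
    ∃ (m : _) (e : SMap (Var (muCtx N E m)) A.El), (clauses N E m).lits.inst e = C + D ∧
      (e₁ ∈ M i → e₂ ∈ M j → e ∈ M m) := by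
  have := A.nonempty
  obtain ⟨x, C, hx, rfl, rfl⟩ := Cls.inst_eq_pos_cons h₁
  obtain ⟨y, D, hy, hyx, rfl⟩ := Cls.inst_eq_neg_cons h₂
  obtain ⟨r, hr, rfl, rfl, rfl, rfl⟩ := exists_resolution hgt hx hy e₁ e₂ hyx.symm
    fun l hl => by
      rw [← Lit.atom_map]
      exact hmax _ (Cls.mem_inst.2 ⟨l, hl, rfl⟩)
  -- The recorded inference may use another most general unifier of the same atoms; `e₁` and `e₂`
  -- factor through that one as well.
  obtain ⟨s, hs, hv, hsx, hsC, hsy, hsD⟩ := hsat.exists_res hr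
  rw [← hsx, ← hsy] at hyx
  obtain ⟨e, rfl, rfl⟩ := hv.exists_comp_eq hyx.symm
  refine ⟨s.k, e.comp s.z, ?_, hM.res i j s hs e⟩
  rw [s.inst_comp (hsat.res_valid i j s hs).2, hsC, hsD]

/-- Lifting of ground factorization. -/
theorem IsCHModel.exists_factor (hgt : IsStableOrder gt) (hsat : IsFiniteSaturation gt N E I)
    {M : MuInterp A (muCtx N E)} (hM : IsCHModel I M) {i} {e₁ : SMap (Var (muCtx N E i)) A.El}
    {a : Atom ar A.El} {C : Cls ar A.El}
    (h₁ : (clauses N E i).lits.inst e₁ = .pos a ::ₘ .pos a ::ₘ C) (hmax : .neg a ∉ C) :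
    ∃ (m : _) (e : SMap (Var (muCtx N E m)) A.El), (clauses N E m).lits.inst e = .pos a ::ₘ C ∧
      (e₁ ∈ M i → e ∈ M m) := by
  have := A.nonempty
  obtain ⟨x, C', hx, rfl, hC'⟩ := Cls.inst_eq_pos_cons h₁
  obtain ⟨y, C, rfl, hyx, rfl⟩ := Cls.inst_eq_pos_cons hC'
  obtain ⟨r, hr, rfl, rfl, rfl⟩ := exists_factorization hgt hx e₁ hyx.symm hmax
  obtain ⟨s, hs, hv, hsx, hsy, hsC⟩ := hsat.exists_fact hr
  rw [← hsx, ← hsy] at hyx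
  obtain ⟨e, rfl⟩ := hv.exists_comp_eq hyx.symm
  refine ⟨s.k, e.comp s.z, ?_, hM.fact i s hs e⟩
  rw [s.inst_comp (hsat.fact_valid i s hs).2, hsC, hsx]

/-- Closure also concerns premises with false constraints. This is why lifting provides the
concluding instance unconditionally and membership in `μ` only as an implication, which is exactly
what redundancy asks for. -/
theorem isGroundSaturation_leastMu (hgt : IsStableOrder gt)
    (hsat : IsFiniteSaturation gt N E I) :
    IsGroundSaturation (leastMu I A) (groundN A N E) (groundMu A N E) where
  contains := by
    rintro _ ⟨i, a, rfl⟩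
    exact ⟨_, ⟨.inl i, a, rfl⟩, rfl, (isCHModel_leastMu I A).base i a⟩
  derived := by
    rintro _ ⟨i, a, rfl⟩ ha
    obtain ⟨ξ, hξ, hM⟩ := exists_gDerivable hsat (leastMu I A) ha
    exact ⟨_, hξ, rfl, hM⟩
  closed := by
    have hM := isCHModel_leastMu I A
    rintro gt' - _ (⟨ξ, ξ', a, C, D, ⟨i, e₁, h₁⟩, ⟨j, e₂, h₂⟩, hC, -⟩ |
      ⟨ξ, a, C, ⟨i, e₁, h₁⟩, hC⟩)
    · rw [GClause.mk.injEq] at h₁ h₂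
      obtain ⟨rfl, h₁⟩ := h₁
      obtain ⟨rfl, h₂⟩ := h₂
      obtain ⟨m, e, he, hm⟩ := hM.exists_resolvent hgt hsat h₁.symm h₂.symm fun l hl h => by
        obtain ⟨h₁, h₂⟩ := hC l hl
        cases l with
        | pos b => exact h₂ (congrArg Lit.pos h)
        | neg b => exact h₁ (.inr ⟨a, congrArg Lit.neg h, rfl⟩)
      exact ⟨_, ⟨m, e, rfl⟩, he.symm, fun h => hm h.1 h.2⟩
    · rw [GClause.mk.injEq] at h₁
      obtain ⟨rfl, h₁⟩ := h₁
      obtain ⟨m, e, he, hm⟩ := hM.exists_factor hgt hsat h₁.symm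
        fun h => hC _ h (.inr ⟨a, rfl, rfl⟩)
      exact ⟨_, ⟨m, e, rfl⟩, he.symm, hm⟩

/-- If `CH_N` has a model over `A` in which the goal clauses hold, then `A ⊨ ∃P N`. -/
theorem IsCHModel.modelsExistsP (hgt : IsStableOrder gt) (hsat : IsFiniteSaturation gt N E I)
    {M : MuInterp A (muCtx N E)} (hM : IsCHModel I M)
    (hbot : ∀ j, (clauses N E j).lits = 0 → ∀ a, a ∉ M j) : A.ModelsExistsP (Set.range N) := by
  -- Any well-order of the ground atoms will do, since lifting only asks that the resolved atom be
  -- absent from the rest of the positive premise.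
  obtain ⟨J, hJ⟩ := exists_model_of_closed
    {C : Cls ar A.El | ∃ i, ∃ a ∈ M i, (clauses N E i).lits.inst a = C}
    (fun a b => WellOrderingRel b a) (fun _ _ _ h h' => _root_.trans h' h)
    (fun a b h => by
      rcases trichotomous_of WellOrderingRel a b with h' | h' | h'
      · exact .inr h'
      · exact absurd h' h
      · exact .inl h')
    WellOrderingRel.isWellOrder.wf
    (by
      rintro a C D ⟨i, e₁, he₁, h₁⟩ ⟨j, e₂, he₂, h₂⟩ hmax
      obtain ⟨m, e, he, hm⟩ := hM.exists_resolvent hgt hsat h₁ h₂ fun l hl h => by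
        have := hmax l hl
        rw [h] at this
        exact irrefl_of WellOrderingRel a this
      exact ⟨m, e, hm he₁ he₂, he⟩)
    (by
      rintro a C ⟨i, e₁, he₁, h₁⟩ hmax
      obtain ⟨m, e, he, hm⟩ := hM.exists_factor hgt hsat h₁ hmax
      exact ⟨m, e, hm he₁, he⟩)
    (by
      rintro ⟨i, a, ha, h⟩
      exact hbot i (Cls.inst_eq_zero.1 h) a ha)
  refine ⟨J, ?_⟩
  rintro _ ⟨i, rfl⟩ e he
  exact hJ _ ⟨.inl i, e, hM.base i e he, rfl⟩

/-! ## Derivable constrained clauses -/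

/-- Every derivable constrained clause is a variant of a listed clause, and its constraint implies
the corresponding predicate. -/
theorem HRes.exists_commonVariant (hgt : IsStableOrder gt) (hsat : IsFiniteSaturation gt N E I)
    {M : MuInterp A (muCtx N E)} (hM : IsCHModel I M) {c : CClause L ar}
    (hc : HRes gt (Set.range N) c) :
    ∃ (i : _) (v : CommonVariant c.toPClause (clauses N E i)), ∀ e, c.constr.Holds A e →
      ∃ a ∈ M i, v.Agree e a := by
  have := A.nonempty
  induction hc with
  | base c hc =>
    obtain ⟨i, rfl⟩ := hc
    exact ⟨.inl i, .refl _, fun e he => ⟨e, hM.base i e he, e, rfl, rfl⟩⟩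
  | res c₁ c₂ r _ _ hr ih₁ ih₂ =>
    obtain ⟨i, v₁, hv₁⟩ := ih₁
    obtain ⟨j, v₂, hv₂⟩ := ih₂
    obtain ⟨r', hr', hrr'⟩ := hr.exists_corresponds hgt v₁ v₂
    obtain ⟨s, hs, hv, hsx, hsC, hsy, hsD⟩ := hsat.exists_res hr'
    have hrs : r.Corresponds v₁ v₂ s.inf :=
      ⟨hsx ▸ hrr'.x, hsC ▸ hrr'.C, hsy ▸ hrr'.y, hsD ▸ hrr'.D⟩
    obtain ⟨v, hv'⟩ := hrs.exists_commonVariant hr hv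
    refine ⟨s.k, v.transVariant (hsat.res_valid i j s hs).2, fun e he => ?_⟩
    change SMap (Var r.ctx) A.El at e
    obtain ⟨he₁, he₂⟩ := (Fm.holds_and (Γ := r.ctx) A _ _ e).1 he
    obtain ⟨a₁, ha₁, hea₁⟩ := hv₁ _ ((Fm.holds_subst A r.σ₁ e _).1 he₁)
    obtain ⟨a₂, ha₂, hea₂⟩ := hv₂ _ ((Fm.holds_subst A r.σ₂ e _).1 he₂)
    -- Agreement carries the equation between the resolved atoms from `e` over to `a₁` and `a₂`,
    -- which therefore factor through the recorded unifier.
    obtain ⟨f, rfl, rfl⟩ := hv.exists_comp_eq (e₁ := a₁) (e₂ := a₂) <|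
      (hea₁.map_eq hrs.x).symm.trans ((hr.map_eq e).trans (hea₂.map_eq hrs.y))
    exact ⟨_, hM.res i j s hs f ha₁ ha₂, (hv' _ e f hea₁ hea₂).transVariant _⟩
  | fact c r _ hr ih =>
    obtain ⟨i, v, hv⟩ := ih
    obtain ⟨r', hr', hrr'⟩ := hr.exists_corresponds hgt v
    obtain ⟨s, hs, hvs, hsx, hsy, hsC⟩ := hsat.exists_fact hr'
    have hrs : r.Corresponds v s.inf := ⟨hsx ▸ hrr'.x, hsy ▸ hrr'.y, hsC ▸ hrr'.C⟩
    obtain ⟨v', hv'⟩ := hrs.exists_commonVariant hr hvs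
    refine ⟨s.k, v'.transVariant (hsat.fact_valid i s hs).2, fun e he => ?_⟩
    change SMap (Var r.ctx) A.El at e
    obtain ⟨a, ha, hea⟩ := hv _ ((Fm.holds_subst A r.σ e _).1 he)
    obtain ⟨f, rfl⟩ := hvs.exists_comp_eq (e := a) <|
      (hea.map_eq hrs.x).symm.trans ((hr.map_eq e).trans (hea.map_eq hrs.y))
    exact ⟨_, hM.fact i s hs f ha, (hv' _ e f hea).transVariant _⟩

/-- Valuations that satisfy `μ_i` in the least model of `CH_N` come from derivable constrained
clauses. -/
theorem exists_hRes (hgt : IsStableOrder gt) (hsat : IsFiniteSaturation gt N E I) {i}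
    {a : SMap (Var (muCtx N E i)) A.El} (ha : a ∈ leastMu I A i) :
    ∃ c, HRes gt (Set.range N) c ∧ ∃ (v : CommonVariant c.toPClause (clauses N E i))
      (e : SMap (Var c.ctx) A.El), c.constr.Holds A e ∧ v.Agree e a := by
  have := A.nonempty
  -- By minimality it suffices that the tuples agreeing with a solution of the constraint of some
  -- derivable clause form a model of `CH_N`.
  refine IsCHModel.leastMu_subset (M := fun i => {a | ∃ c, HRes gt (Set.range N) c ∧
    ∃ (v : CommonVariant c.toPClause (clauses N E i)) (e : SMap (Var c.ctx) A.El),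
      c.constr.Holds A e ∧ v.Agree e a}) ⟨?_, ?_, ?_⟩ i ha
  · exact fun i a ha => ⟨N i, .base _ ⟨i, rfl⟩, .refl _, a, ha, a, rfl, rfl⟩
  · rintro i j s hs f ⟨c₁, hc₁, v₁, e₁, he₁, hea₁⟩ ⟨c₂, hc₂, v₂, e₂, he₂, hea₂⟩
    obtain ⟨hv, hz⟩ := hsat.res_valid i j s hs
    obtain ⟨r, hr, hsr⟩ := hv.exists_corresponds hgt v₁.symm v₂.symm
    obtain ⟨v, hv'⟩ := hsr.exists_commonVariant hv hr
    obtain ⟨e, rfl, rfl⟩ := hr.exists_comp_eq (e₁ := e₁) (e₂ := e₂) <|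
      (hea₁.map_eq hsr.symm.x).trans ((hv.map_eq f).trans (hea₂.map_eq hsr.symm.y).symm)
    exact ⟨_, .res c₁ c₂ r hc₁ hc₂ hr, v.symm.transVariant hz, e,
      (Fm.holds_and (Γ := r.ctx) A _ _ e).2
        ⟨(Fm.holds_subst A r.σ₁ e _).2 he₁, (Fm.holds_subst A r.σ₂ e _).2 he₂⟩,
      (hv' _ f e hea₁.symm hea₂.symm).symm.transVariant hz⟩
  · rintro i s hs f ⟨c, hc, v, e, he, hea⟩
    obtain ⟨hvs, hz⟩ := hsat.fact_valid i s hs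
    obtain ⟨r, hr, hsr⟩ := hvs.exists_corresponds hgt v.symm
    obtain ⟨v', hv'⟩ := hsr.exists_commonVariant hvs hr
    obtain ⟨e, rfl⟩ := hr.exists_comp_eq (e := e) <|
      (hea.map_eq hsr.symm.x).trans ((hvs.map_eq f).trans (hea.map_eq hsr.symm.y).symm)
    exact ⟨_, .fact c r hc hr, v'.symm.transVariant hz, e, (Fm.holds_subst A r.σ e _).2 he,
      (hv' _ f e hea.symm).symm.transVariant hz⟩

theorem exists_hRes_inst_eq_iff (hgt : IsStableOrder gt) (hsat : IsFiniteSaturation gt N E I)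
    (D : Cls ar A.El) :
    (∃ c, HRes gt (Set.range N) c ∧ ∃ a, c.constr.Holds A a ∧ c.lits.inst a = D) ↔
      ∃ i, ∃ a ∈ leastMu I A i, (clauses N E i).lits.inst a = D := by
  constructor
  · rintro ⟨c, hc, e, he, rfl⟩
    obtain ⟨i, v, hv⟩ := hc.exists_commonVariant hgt hsat (isCHModel_leastMu I A)
    obtain ⟨a, ha, hea⟩ := hv e he
    exact ⟨i, a, ha, hea.inst_eq.symm⟩
  · rintro ⟨i, a, ha, rfl⟩
    obtain ⟨c, hc, v, e, he, hea⟩ := exists_hRes hgt hsat ha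
    exact ⟨c, hc, e, he, hea.inst_eq⟩

/-- Elementarily equivalent structures satisfy the same sentences `∃P N`, provided that the
saturation of `N` is finite. -/
theorem Str.ModelsExistsP.of_models_th (hgt : IsStableOrder gt)
    (hsat : IsFiniteSaturation gt N E I) {B : Str.{u, w} L} (hB : ∀ ψ ∈ A.Th, B.Models ψ)
    (h : B.ModelsExistsP (Set.range N)) : A.ModelsExistsP (Set.range N) := by
  refine (isCHModel_leastMu I A).modelsExistsP hgt hsat fun j hj a ha => ?_
  obtain ⟨c, hc, e, he, hce⟩ := (exists_hRes_inst_eq_iff hgt hsat 0).2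
    ⟨j, a, ha, Cls.inst_eq_zero.2 hj⟩
  obtain ⟨e', he'⟩ := Fm.exists_holds_of_models_th A hB c.constr he
  obtain ⟨J, hJ⟩ := h
  obtain ⟨l, hl, -⟩ := hc.sound hJ e' he'
  rw [Cls.inst_eq_zero.1 hce] at hl
  simp [Cls.inst] at hl

end Saturation

theorem mainTheorem4 {L : Sig.{u}} {ar : List L.Srt} (T : Set (Str.{u, w} L))
    (gt : ∀ Γ : List L.Srt, Atom ar (Var Γ) → Atom ar (Var Γ) → Prop) (hgt : IsStableOrder gt)
    {n k : ℕ} (N : Fin n → CClause L ar) (E : Fin k → PClause ar) (I : InferenceSet (clauses N E))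
    (hsat : IsFiniteSaturation gt N E I) :
    ((∀ i, (clauses N E i).lits ≠ 0) → EquivMod T Fm.verum (Set.range N)) ∧
    ((∃ j, (clauses N E j).lits = 0) → ∀ A ∈ T,
      ∃ μ : MuInterp A (muCtx N E),
        IsLeast {M | HornModels A M (CH N E I)} μ ∧
        IsGroundSaturation μ (groundN A N E) (groundMu A N E) ∧
        (∀ D : Cls ar A.El,
          (∃ c, HRes gt (Set.range N) c ∧ ∃ a, c.constr.Holds A a ∧ c.lits.inst a = D) ↔
          (∃ i, ∃ a ∈ μ i, (clauses N E i).lits.inst a = D)) ∧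
        (A.ModelsExistsP (Set.range N) ↔ SatisfiableModTh A (CH N E I ∪ negMuBot N E)) ∧
        (A.ModelsExistsP (Set.range N) ↔ HornModels A μ (negMuBot N E))) := by
  refine ⟨fun h A _ => iff_of_true (Fm.holds_verum A _)
    ((isCHModel_leastMu I A).modelsExistsP hgt hsat fun j hj => absurd hj (h j)), fun _ A _ => ?_⟩
  have goal : ∀ J : Set (Atom ar A.El), ∀ j, (clauses N E j).lits = 0 →
      ∀ a : SMap (Var (muCtx N E j)) A.El, ¬ ((clauses N E j).lits.inst a).True J := by
    rintro J j hj a ⟨l, hl, -⟩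
    rw [hj] at hl
    simp [Cls.inst] at hl
  refine ⟨leastMu I A, isLeast_leastMu I A, isGroundSaturation_leastMu hgt hsat,
    exists_hRes_inst_eq_iff hgt hsat, ⟨?_, ?_⟩, ⟨?_, ?_⟩⟩
  -- `A` itself, expanded by the truth sets of the `C_i`, is the required model.
  · rintro ⟨J, hJ⟩
    refine ⟨A, fun ψ hψ => hψ, _, fun h hh => hh.elim
      (hornModels_CH_iff.2 (isCHModel_of_true hsat hJ) h) (hornModels_negMuBot_iff.2 (goal J) h)⟩
  -- The `μ_i` on `B` need not transfer to `A`, but they give `B ⊨ ∃P N`, which does.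
  · rintro ⟨B, hB, M, hM⟩
    exact Str.ModelsExistsP.of_models_th hgt hsat hB <|
      (hornModels_CH_iff.1 fun h hh => hM h (.inl hh)).modelsExistsP hgt hsat
        (hornModels_negMuBot_iff.1 fun h hh => hM h (.inr hh))
  · rintro ⟨J, hJ⟩
    exact hornModels_negMuBot_iff.2 fun j hj a ha =>
      goal J j hj a ((isCHModel_of_true hsat hJ).leastMu_subset j ha)
  · exact fun h => (isCHModel_leastMu I A).modelsExistsP hgt hsat (hornModels_negMuBot_iff.1 h)
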